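/- **Conventions.** Let $d\ge 0$ be an integer; $S^*(\mathbb R^d)$ denotes the space of temperate distributions, and $\hat\varphi(y)=\int_{\mathbb R^d}\varphi(x)e^{-2\pi i\langle x,y\rangle}dx$ for Schwartz functions $\varphi$, $\hat f(\varphi)=f(\hat\varphi)$ for $f\in S^*(\mathbb R^d)$. The spectrum of $f$ is $\operatorname{supp}\hat f$. For $k\in(\mathbb N\cup\{0\})^d$ put $\|k\|=k_1+\dots+k_d$ and $D^k=\partial_{x_1}^{k_1}\cdots\partial_{x_d}^{k_d}$; $\delta_\lambda$ is the unit mass at $\lambda$. A set $A\subset\mathbb R^d$ is locally finite if every ball contains finitely many points of $A$; it is of bounded density if it is locally finite and $\sup_{x}\#(A\cap B(x,1))<\infty$; its separating constant is $\eta(A)=\inf\{|x-x'|:x,x'\in A,\ x\ne x'\}\in[0,\infty]$ (equal to $+\infty$ if $A$ has at most one point); and $A$ is uniformly discrete if it is locally finite and $\eta(A)>0$. Sums of point distributions over locally finite sets are understood as locally finite sums of distributions. **Theorem.** Let $f\in S^*(\mathbb R^d)$ have support $\Lambda$ of bounded density and uniformly discrete spectrum $\Gamma$, and let $$f=\sum_{\lambda\in\Lambda}\sum_k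 p_k(\lambda)D^k\delta_\lambda,\qquad p_k(\lambda)\in\mathbb C,$$ where for every $\lambda\in\Lambda$ the inner sum over $k\in(\mathbb N\cup\{0\})^d$ is finite. For each $k$ set $\mu_k=\sum_{\lambda\in\Lambda}p_k(\lambda)\delta_\lambda$. (a) If the $p_k(\lambda)$ are bounded uniformly in $k$ and $\lambda\in\Lambda$, then for every $k$ we have $\mu_k\in S^*(\mathbb R^d)$, and, with $\Gamma_k=\operatorname{supp}\hat\mu_k$, the set $\Gamma_k$ is uniformly discrete, $\eta(\Gamma_k)\ge\eta(\Gamma)$, and $\hat\mu_k$ is a measure of the form $$\hat\mu_k=\sum_{\gamma\in\Gamma_k}q_k(\gamma)\delta_\gamma$$ with masses $q_k(\gamma)$ bounded uniformly in $k$ and $\gamma\in\Gamma_k$. (b) If $\Lambda$ is also uniformly discrete, then for every $k$ we have $\mu_k\in S^*(\mathbb R^d)$, and, with $\Gamma_k=\operatorname{supp}\hat\mu_k$, the set $\Gamma_k$ is uniformly discrete, $\eta(\Gamma_k)\ge\eta(\Gamma)$, and $$\hat\mu_k=\sum_{\|m\|\le M}\sum_{\gamma\in\Gamma_k}q_{k,m}(\gamma)D^m\delta_\gamma$$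 with some $M<\infty$ independent of $k$ and coefficients $q_{k,m}(\gamma)$ bounded uniformly in $k$, $m$ and $\gamma\in\Gamma_k$. -/

import Mathlib

open scoped SchwartzMap FourierTransform LineDeriv
open Distribution

noncomputable section

namespace DiscreteDistribution

/-- The Euclidean space `ℝ^d`. -/
abbrev Euc (d : ℕ) : Type := EuclideanSpace ℝ (Fin d)

/-- Every ball contains only finitely many points of `A`. -/
def IsLocallyFinite {d : ℕ} (A : Set (Euc d)) : Prop :=
  ∀ (x : Euc d) (r : ℝ), (A ∩ Metric.ball x r).Finite

/-- The separating constant: the infimum of `|x - x'|` over distinct `x, x' ∈ A`, in `[0, ∞]`;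
it is `∞` when `A` has at most one point. -/
def sepConst {d : ℕ} (A : Set (Euc d)) : ENNReal := A.einfsep

/-- `A` is locally finite with a strictly positive separating constant. -/
def IsUniformlyDiscrete {d : ℕ} (A : Set (Euc d)) : Prop :=
  IsLocallyFinite A ∧ 0 < sepConst A

/-- `A` is locally finite and the number of points of `A` in a unit ball is bounded. -/
def HasBoundedDensity {d : ℕ} (A : Set (Euc d)) : Prop :=
  IsLocallyFinite A ∧ ∃ N : ℕ, ∀ x : Euc d, (A ∩ Metric.ball x 1).ncard ≤ N

/-- The support of a temperate distribution. -/
def supp {d : ℕ} (f : 𝓢'(Euc d, ℂ)) : Set (Euc d) := dsupport f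

/-- The spectrum: the support of the Fourier transform. -/
def spec {d : ℕ} (f : 𝓢'(Euc d, ℂ)) : Set (Euc d) := supp (𝓕 f)

/-- The length `‖k‖ = k₁ + ⋯ + k_d` of a multi-index. -/
def len {d : ℕ} (k : Fin d → ℕ) : ℕ := ∑ i, k i

/-- The operator `D^k = ∂₁^{k₁} ⋯ ∂_d^{k_d}` on temperate distributions. -/
def multiDeriv {d : ℕ} (k : Fin d → ℕ) (f : 𝓢'(Euc d, ℂ)) : 𝓢'(Euc d, ℂ) :=
  (List.finRange d).foldr
    (fun i g => (fun h : 𝓢'(Euc d, ℂ) => ∂_{EuclideanSpace.single i (1 : ℝ)} h)^[k i] g) f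

/-- `f = ∑_{a ∈ A} c(a) δ_a` as distributions (`A` locally finite): equality is tested
on smooth functions with compact support, for which the sum has finitely many nonzero terms. -/
def IsDeltaSum {d : ℕ} (f : 𝓢'(Euc d, ℂ)) (A : Set (Euc d)) (c : Euc d → ℂ) : Prop :=
  ∀ φ : 𝓢(Euc d, ℂ), HasCompactSupport φ →
    HasSum (fun a : A => c a * TemperedDistribution.delta (a : Euc d) φ) (f φ)

/-- `f = ∑_{a ∈ A} ∑_k p_k(a) D^k δ_a` as distributions (`A` locally finite), where `p a` is the
finitely supported family `k ↦ p_k(a)`, tested on smooth functions with compact support. -/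
def IsDeltaDerivSum {d : ℕ} (f : 𝓢'(Euc d, ℂ)) (A : Set (Euc d))
    (p : Euc d → ((Fin d → ℕ) →₀ ℂ)) : Prop :=
  ∀ φ : 𝓢(Euc d, ℂ), HasCompactSupport φ →
    HasSum (fun a : A =>
      (p a).sum fun k c => c * multiDeriv k (TemperedDistribution.delta (a : Euc d)) φ) (f φ)

end DiscreteDistribution

end

/-! Write f = ∑ D^k μ_k, a finite sum because a temperate distribution has finite order. On the
Fourier side this reads f̂ = ∑ (2πi y)^k ν_k with ν_k = μ̂_k. Everything rests on two properties of
ν_k, which come from μ_k being a sum of point masses of polynomial growth on a set of bounded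
density.

Recurrence. Translating ν_k by t multiplies the mass at λ by a character. In a product of circles
the powers of any element return to the identity, so along a suitable filter of integers n the
translates of all ν_k by nω return to ν_k (`exists_recurrence_filter`, `tendsto_fourier_translate`).
The monomials, in contrast, grow under translation. Suppose g₁ and g₂ are closer than η(Γ), and φ₁,
φ₂ are supported near them. For each t, f̂ annihilates the t-translate of φ₁ or that of φ₂, since
otherwise Γ would contain two distinct points that are too close. The product of the two pairings
vanishes for every t, and along a line it is a polynomial in t with recurrent coefficients. Dividing
by the top power and going to infinity removes the coefficients one by one
(`polynomial_eq_zero_of_recurrent`). Polynomials over ℂ form a domain, so one factor vanishes, and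
its coefficients give ν_k = 0 near g₁ for all k or near g₂ for all k (`le_edist_of_mem_supp`). Hence
η(Γ_k) ≥ η(Γ).

Scaling. If |p_k(λ)| ≤ C(1+|λ|)^N, then ν_k grows at most like ε^(-N) on test functions shrunk by ε,
uniformly in k and in the centre (`HasBoundedDensity.exists_fourier_rescale_bound`). On the shrunk
function dual to D^m, a term q D^m δ_γ contributes q ε^(-‖m‖). So orders above N are absent, and
taking ε to be an isolation radius bounds q (`exists_coeff_bound`). Part (a) is N = 0. In part (b)
the same scaling argument applied to f itself supplies the polynomial growth
(`IsDeltaDerivSum.exists_order_growth`). -/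

noncomputable section

namespace DiscreteDistribution

variable {d : ℕ}

/-! ### Multi-index derivatives and their duals on test functions -/

/-- The continuous linear operator `-∂ᵢ` on Schwartz functions. -/
def negPartial (i : Fin d) : 𝓢(Euc d, ℂ) →L[ℂ] 𝓢(Euc d, ℂ) :=
  -LineDeriv.lineDerivOpCLM ℂ 𝓢(Euc d, ℂ) (EuclideanSpace.single i (1 : ℝ))

theorem negPartial_apply (i : Fin d) (φ : 𝓢(Euc d, ℂ)) :
    negPartial i φ = -∂_{EuclideanSpace.single i (1 : ℝ)} φ := rfl

theorem negPartial_apply_apply (i : Fin d) (φ : 𝓢(Euc d, ℂ)) (x : Euc d) :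
    negPartial i φ x = -fderiv ℝ φ x (EuclideanSpace.single i (1 : ℝ)) := rfl

theorem lineDerivOp_comm (v w : Euc d) (φ : 𝓢(Euc d, ℂ)) : ∂_{v} (∂_{w} φ) = ∂_{w} (∂_{v} φ) := by
  have key : ∀ (v w x : Euc d), (∂_{v} (∂_{w} φ)) x = fderiv ℝ (fderiv ℝ φ) x v w := by
    intro v w x
    have h : ∀ y, (∂_{w} φ) y = fderiv ℝ φ y w := fun y => rfl
    rw [SchwartzMap.lineDerivOp_apply_eq_fderiv]
    have : ((∂_{w} φ : 𝓢(Euc d, ℂ)) : Euc d → ℂ) = fun y => fderiv ℝ φ y w := funext h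
    rw [this, fderiv_clm_apply]
    · simp
    · exact ((φ.smooth 2).fderiv_right (m := 1) le_rfl).differentiable (by simp) x
    · fun_prop
  ext x
  rw [key, key]
  exact ((φ.contDiffAt 2).isSymmSndFDerivAt (by simp)) v w

theorem negPartial_commute (i j : Fin d) : Commute (negPartial i) (negPartial j) := by
  ext φ : 1
  simp only [mul_apply_eq_comp, negPartial_apply, LineDeriv.lineDerivOp_neg]
  rw [lineDerivOp_comm]

/-- The composition of the operators `-∂ᵢ` along a word. -/
def wordDeriv (w : List (Fin d)) : 𝓢(Euc d, ℂ) →L[ℂ] 𝓢(Euc d, ℂ) :=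
  (w.map negPartial).prod

@[simp] theorem wordDeriv_nil : wordDeriv ([] : List (Fin d)) = 1 := rfl

@[simp] theorem wordDeriv_cons (i : Fin d) (w : List (Fin d)) :
    wordDeriv (i :: w) = negPartial i * wordDeriv w := by simp [wordDeriv]

theorem wordDeriv_perm {v w : List (Fin d)} (h : v.Perm w) : wordDeriv v = wordDeriv w := by
  refine (h.map negPartial).prod_eq' ?_
  rw [List.pairwise_map]
  exact List.pairwise_of_forall fun i j => negPartial_commute i j

theorem wordDeriv_append (v w : List (Fin d)) :
    wordDeriv (v ++ w) = wordDeriv v * wordDeriv w := by simp [wordDeriv]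

/-- The word in which the letter `i` occurs `k i` times, in increasing order. -/
def sortedWord (k : Fin d → ℕ) : List (Fin d) :=
  (List.finRange d).flatMap fun i => List.replicate (k i) i

theorem count_sortedWord (k : Fin d → ℕ) (i : Fin d) : (sortedWord k).count i = k i := by
  rw [sortedWord, List.count_flatMap]
  simp only [Function.comp_def, List.count_replicate]
  have : (List.map (fun x => if (x == i) = true then k x else 0) (List.finRange d)).sum
      = ∑ x : Fin d, if (x == i) = true then k x else 0 := by
    rw [Fin.sum_univ_def]
  rw [this]; simp

theorem sortedWord_perm (w : List (Fin d)) : (sortedWord fun i => w.count i).Perm w :=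
  List.perm_iff_count.2 fun i => count_sortedWord _ i

theorem length_sortedWord (k : Fin d → ℕ) : (sortedWord k).length = len k := by
  simp [sortedWord, List.length_flatMap, len, Fin.sum_univ_def]

theorem len_count (w : List (Fin d)) : len (fun i => w.count i) = w.length := by
  rw [← length_sortedWord, (sortedWord_perm w).length_eq]

/-- The operator `∏ᵢ (-∂ᵢ)^{kᵢ}` on Schwartz functions, dual to `D^k`. -/
def dualDeriv (k : Fin d → ℕ) : 𝓢(Euc d, ℂ) →L[ℂ] 𝓢(Euc d, ℂ) := wordDeriv (sortedWord k)

theorem wordDeriv_eq_dualDeriv (w : List (Fin d)) :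
    wordDeriv w = dualDeriv fun i => w.count i := (wordDeriv_perm (sortedWord_perm w)).symm

theorem iterate_lineDerivOp_apply (i : Fin d) (n : ℕ) (f : 𝓢'(Euc d, ℂ)) (φ : 𝓢(Euc d, ℂ)) :
    ((fun h : 𝓢'(Euc d, ℂ) => ∂_{EuclideanSpace.single i (1 : ℝ)} h)^[n] f) φ =
      f (wordDeriv (List.replicate n i) φ) := by
  induction n generalizing f φ with
  | zero => rfl
  | succ n ih =>
    rw [Function.iterate_succ_apply, ih, List.replicate_succ, wordDeriv_cons]
    rfl

theorem multiDeriv_apply (k : Fin d → ℕ) (f : 𝓢'(Euc d, ℂ)) (φ : 𝓢(Euc d, ℂ)) :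
    multiDeriv k f φ = f (dualDeriv k φ) := by
  have key : ∀ (l : List (Fin d)) (φ : 𝓢(Euc d, ℂ)), (l.foldr
      (fun i g => (fun h : 𝓢'(Euc d, ℂ) => ∂_{EuclideanSpace.single i (1 : ℝ)} h)^[k i] g) f) φ =
      f (wordDeriv (l.flatMap fun i => List.replicate (k i) i) φ) := by
    intro l
    induction l with
    | nil => intro φ; rfl
    | cons i l ih =>
      intro φ
      -- Duality reverses the order of the operators; commutation restores it.
      rw [List.foldr_cons, iterate_lineDerivOp_apply, ih, List.flatMap_cons,
        wordDeriv_perm List.perm_append_comm, wordDeriv_append]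
      rfl
  exact key _ _

theorem tsupport_wordDeriv_subset (w : List (Fin d)) (φ : 𝓢(Euc d, ℂ)) :
    tsupport (wordDeriv w φ) ⊆ tsupport φ := by
  induction w with
  | nil => exact subset_rfl
  | cons i w ih =>
    rw [wordDeriv_cons]
    refine subset_trans ?_ ih
    change tsupport (-((∂_{EuclideanSpace.single i (1 : ℝ)} (wordDeriv w φ) : 𝓢(Euc d, ℂ)) :
      Euc d → ℂ)) ⊆ _
    rw [tsupport_neg]
    exact SchwartzMap.tsupport_lineDerivOp_subset _ _

theorem tsupport_dualDeriv_subset (k : Fin d → ℕ) (φ : 𝓢(Euc d, ℂ)) :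
    tsupport (dualDeriv k φ) ⊆ tsupport φ := tsupport_wordDeriv_subset _ _

theorem dualDeriv_apply_eq_zero {k : Fin d → ℕ} {φ : 𝓢(Euc d, ℂ)} {x : Euc d}
    (h : x ∉ tsupport φ) : dualDeriv k φ x = 0 :=
  image_eq_zero_of_notMem_tsupport fun hx => h (tsupport_dualDeriv_subset k φ hx)

theorem dualDeriv_congr {k : Fin d → ℕ} {φ ψ : 𝓢(Euc d, ℂ)} {x : Euc d}
    (h : (φ : Euc d → ℂ) =ᶠ[nhds x] ψ) : dualDeriv k φ x = dualDeriv k ψ x := by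
  rw [← sub_eq_zero, ← sub_apply, ← map_sub]
  refine dualDeriv_apply_eq_zero ?_
  rw [notMem_tsupport_iff_eventuallyEq]
  filter_upwards [h] with y hy
  simp [hy]

@[simp] theorem dualDeriv_zero : dualDeriv (0 : Fin d → ℕ) = 1 := by
  have : sortedWord (0 : Fin d → ℕ) = [] := by
    rw [← List.length_eq_zero_iff, length_sortedWord]; simp [len]
  rw [dualDeriv, this, wordDeriv_nil]

theorem iteratedLineDerivOp_single (n : ℕ) (w : Fin n → Fin d) (φ : 𝓢(Euc d, ℂ)) :
    ∂^{fun j => EuclideanSpace.single (w j) (1 : ℝ)} φ = (-1 : ℂ) ^ n • wordDeriv (List.ofFn w) φ := by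
  induction n with
  | zero => simp
  | succ n ih =>
    rw [LineDeriv.iteratedLineDerivOp_succ_left]
    have := ih (Fin.tail w)
    rw [show Fin.tail (fun j => EuclideanSpace.single (w j) (1 : ℝ)) =
      (fun j => EuclideanSpace.single (Fin.tail w j) (1 : ℝ)) from rfl, this, List.ofFn_succ,
      wordDeriv_cons, LineDeriv.lineDerivOp_smul, mul_apply_eq_comp, negPartial_apply,
      pow_succ]
    simp [Fin.tail_def]

/-- A multilinear map is determined on tuples of basis vectors, where the iterated derivative is, up
to sign, some `dualDeriv`. This turns finitely many scalar conditions into a vanishing jet. -/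
theorem iteratedFDeriv_eq_zero_of_dualDeriv {M n : ℕ} {φ : 𝓢(Euc d, ℂ)} {x : Euc d}
    (h : ∀ k : Fin d → ℕ, len k ≤ M → dualDeriv k φ x = 0) (hn : n ≤ M) :
    iteratedFDeriv ℝ n φ x = 0 := by
  apply ContinuousMultilinearMap.toMultilinearMap_injective
  refine Module.Basis.ext_multilinear (fun _ => (EuclideanSpace.basisFun (Fin d) ℝ).toBasis)
    fun w => ?_
  have : (fun j => ((EuclideanSpace.basisFun (Fin d) ℝ).toBasis) (w j)) =
    fun j => EuclideanSpace.single (w j) (1 : ℝ) := by ext1 j; simp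
  rw [this]
  change iteratedFDeriv ℝ n φ x _ = 0
  rw [← SchwartzMap.iteratedLineDerivOp_eq_iteratedFDeriv, iteratedLineDerivOp_single,
    wordDeriv_eq_dualDeriv, smul_apply, h _ (by rw [len_count]; simpa using hn),
    smul_zero]

/-! ### Dilations, monomials and the Fourier transform -/

/-- The Schwartz function `x ↦ φ (ε⁻¹ (x - a))`. -/
def rescale (a : Euc d) (ε : ℝ) (hε : 0 < ε) : 𝓢(Euc d, ℂ) →L[ℂ] 𝓢(Euc d, ℂ) :=
  (SchwartzMap.compSubConstCLM ℂ a).comp (SchwartzMap.compCLMOfContinuousLinearEquiv ℂ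
    (ContinuousLinearEquiv.smulLeft (R₁ := ℝ) (M₁ := Euc d) (Units.mk0 ε⁻¹ (inv_ne_zero hε.ne'))))

theorem rescale_apply (a : Euc d) (ε : ℝ) (hε : 0 < ε) (φ : 𝓢(Euc d, ℂ)) (x : Euc d) :
    rescale a ε hε φ x = φ (ε⁻¹ • (x - a)) := rfl

theorem fderiv_rescale (a : Euc d) (ε : ℝ) (hε : 0 < ε) (φ : 𝓢(Euc d, ℂ)) (x : Euc d) :
    fderiv ℝ (rescale a ε hε φ) x = ε⁻¹ • fderiv ℝ φ (ε⁻¹ • (x - a)) := by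
  have h1 : HasFDerivAt (fun x : Euc d => ε⁻¹ • (x - a))
      (ε⁻¹ • ContinuousLinearMap.id ℝ (Euc d)) x := ((hasFDerivAt_id x).sub_const a).const_smul ε⁻¹
  have h2 := (φ.hasFDerivAt (ε⁻¹ • (x - a))).comp x h1
  have h3 : (rescale a ε hε φ : Euc d → ℂ) = φ ∘ fun x : Euc d => ε⁻¹ • (x - a) := rfl
  rw [h3, h2.fderiv]
  ext v
  simp

theorem wordDeriv_rescale (w : List (Fin d)) (a : Euc d) (ε : ℝ) (hε : 0 < ε) (φ : 𝓢(Euc d, ℂ)) :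
    wordDeriv w (rescale a ε hε φ) = ((ε : ℂ)⁻¹ ^ w.length) • rescale a ε hε (wordDeriv w φ) := by
  induction w with
  | nil => simp
  | cons i w ih =>
    rw [wordDeriv_cons, mul_apply_eq_comp, ih, map_smul, List.length_cons, pow_succ, mul_smul]
    congr 1
    ext x
    rw [negPartial_apply_apply, fderiv_rescale, smul_apply, smul_apply, rescale_apply,
      mul_apply_eq_comp, negPartial_apply_apply]
    simp

theorem dualDeriv_rescale (k : Fin d → ℕ) (a : Euc d) (ε : ℝ) (hε : 0 < ε) (φ : 𝓢(Euc d, ℂ))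
    (x : Euc d) : dualDeriv k (rescale a ε hε φ) x =
      (ε : ℂ)⁻¹ ^ len k * dualDeriv k φ (ε⁻¹ • (x - a)) := by
  rw [dualDeriv, wordDeriv_rescale, length_sortedWord, smul_apply, rescale_apply, smul_eq_mul]

theorem tsupport_rescale_subset {a : Euc d} {ε r : ℝ} (hε : 0 < ε) {φ : 𝓢(Euc d, ℂ)}
    (h : tsupport φ ⊆ Metric.closedBall 0 r) :
    tsupport (rescale a ε hε φ) ⊆ Metric.closedBall a (ε * r) := by
  refine closure_minimal (fun x hx => ?_) Metric.isClosed_closedBall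
  have := h (subset_tsupport _ (show ε⁻¹ • (x - a) ∈ Function.support φ from hx))
  rw [mem_closedBall_zero_iff, norm_smul, norm_inv, Real.norm_of_nonneg hε.le,
    inv_mul_le_iff₀ hε] at this
  rwa [mem_closedBall_iff_norm]

/-- Multiplication of Schwartz functions by `∏ⱼ (2πi yⱼ)^{kⱼ}`. -/
def mulMonomial (k : Fin d → ℕ) : 𝓢(Euc d, ℂ) →L[ℂ] 𝓢(Euc d, ℂ) :=
  SchwartzMap.smulLeftCLM ℂ fun y : Euc d => ∏ j, (2 * Real.pi * Complex.I * (y j : ℂ)) ^ k j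

theorem hasTemperateGrowth_coord (j : Fin d) :
    Function.HasTemperateGrowth fun y : Euc d => (y j : ℂ) :=
  (Complex.ofRealCLM ∘L EuclideanSpace.proj (𝕜 := ℝ) j).hasTemperateGrowth

theorem hasTemperateGrowth_prod {ι : Type*} (s : Finset ι) (g : ι → Euc d → ℂ)
    (h : ∀ i ∈ s, (g i).HasTemperateGrowth) :
    Function.HasTemperateGrowth fun y => ∏ i ∈ s, g i y := by
  classical
  induction s using Finset.induction_on with
  | empty => simp
  | insert i s hi ih =>
    simp only [Finset.prod_insert hi]
    exact (h i (by simp)).mul (ih fun j hj => h j (by simp [hj]))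

theorem hasTemperateGrowth_pow {g : Euc d → ℂ} (h : g.HasTemperateGrowth) (n : ℕ) :
    Function.HasTemperateGrowth fun y => g y ^ n := by
  induction n with
  | zero => simp
  | succ n ih => simp only [pow_succ]; exact ih.mul h

theorem mulMonomial_apply (k : Fin d → ℕ) (φ : 𝓢(Euc d, ℂ)) (y : Euc d) :
    mulMonomial k φ y = (∏ j, (2 * Real.pi * Complex.I * (y j : ℂ)) ^ k j) * φ y := by
  rw [mulMonomial, SchwartzMap.smulLeftCLM_apply_apply, smul_eq_mul]
  exact hasTemperateGrowth_prod _ _ fun j _ => hasTemperateGrowth_pow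
    ((Function.HasTemperateGrowth.const _).mul (hasTemperateGrowth_coord j)) _

theorem negPartial_fourier (i : Fin d) (φ ψ : 𝓢(Euc d, ℂ))
    (h : ∀ y, ψ y = 2 * Real.pi * Complex.I * (y i : ℂ) * φ y) :
    negPartial i (𝓕 φ) = 𝓕 ψ := by
  rw [negPartial_apply, SchwartzMap.lineDerivOp_fourier_eq, ← FourierTransform.fourier_neg]
  congr 1
  ext y
  have ht : Function.HasTemperateGrowth
      fun y : Euc d => inner ℝ y (EuclideanSpace.single i (1 : ℝ)) := by fun_prop
  rw [h, neg_apply, smul_apply, SchwartzMap.smulLeftCLM_apply_apply ht]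
  simp [EuclideanSpace.inner_single_right]
  ring

/-- The minus sign of each `negPartial` cancels the one produced by differentiating the kernel
e^(-2πi⟨x,y⟩), so no sign remains. -/
theorem dualDeriv_fourier (k : Fin d → ℕ) (φ : 𝓢(Euc d, ℂ)) :
    dualDeriv k (𝓕 φ) = 𝓕 (mulMonomial k φ) := by
  have key : ∀ w : List (Fin d), ∃ ψ : 𝓢(Euc d, ℂ), wordDeriv w (𝓕 φ) = 𝓕 ψ ∧
      ∀ y, ψ y = (w.map fun i => 2 * Real.pi * Complex.I * (y i : ℂ)).prod * φ y := by
    intro w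
    induction w with
    | nil => exact ⟨φ, rfl, by simp⟩
    | cons i w ih =>
      obtain ⟨ψ, h1, h2⟩ := ih
      have ht : Function.HasTemperateGrowth
          fun y : Euc d => 2 * Real.pi * Complex.I * (y i : ℂ) :=
        (Function.HasTemperateGrowth.const _).mul (hasTemperateGrowth_coord i)
      refine ⟨SchwartzMap.smulLeftCLM ℂ (fun y : Euc d => 2 * Real.pi * Complex.I * (y i : ℂ)) ψ,
        ?_, fun y => ?_⟩
      · rw [wordDeriv_cons, mul_apply_eq_comp, h1]
        refine negPartial_fourier i _ _ fun y => ?_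
        rw [SchwartzMap.smulLeftCLM_apply_apply ht, smul_eq_mul]
      · rw [SchwartzMap.smulLeftCLM_apply_apply ht, h2, smul_eq_mul, List.map_cons,
          List.prod_cons]
        ring
  obtain ⟨ψ, h1, h2⟩ := key (sortedWord k)
  rw [dualDeriv, h1]
  congr 1
  ext y
  rw [h2, mulMonomial_apply]
  congr 1
  rw [Finset.prod_list_map_count]
  simp only [count_sortedWord]
  refine Finset.prod_subset (Finset.subset_univ _) fun i _ hi => ?_
  rw [List.mem_toFinset] at hi
  rw [← count_sortedWord k i, List.count_eq_zero.2 hi, pow_zero]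

/-- The factor ε^d will compensate exactly for the roughly ε^(-d) points of a set of bounded density
at which the dilated transform is not small. -/
theorem fourier_rescale (a : Euc d) (ε : ℝ) (hε : 0 < ε) (φ : 𝓢(Euc d, ℂ)) (ξ : Euc d) :
    𝓕 (rescale a ε hε φ) ξ =
      (ε : ℂ) ^ d * (Real.fourierChar (-inner ℝ a ξ) : ℂ) * 𝓕 φ (ε • ξ) := by
  rw [SchwartzMap.fourier_coe, SchwartzMap.fourier_coe, Real.fourier_eq, Real.fourier_eq]
  have h1 := MeasureTheory.integral_sub_right_eq_self (μ := MeasureTheory.volume)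
    (fun v : Euc d => Real.fourierChar (-inner ℝ (v + a) ξ) • φ (ε⁻¹ • v)) a
  simp only [sub_add_cancel] at h1
  simp only [rescale_apply]
  rw [h1]
  have h2 := MeasureTheory.Measure.integral_comp_smul
    (MeasureTheory.volume : MeasureTheory.Measure (Euc d))
    (fun v : Euc d => Real.fourierChar (-inner ℝ (ε • v + a) ξ) • φ v) ε⁻¹
  simp only [smul_inv_smul₀ hε.ne', finrank_euclideanSpace, Fintype.card_fin] at h2
  rw [h2, abs_of_pos (by positivity), inv_pow, inv_inv]
  rw [Complex.real_smul, Complex.ofReal_pow, mul_assoc,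
    ← MeasureTheory.integral_const_mul (Real.fourierChar (-inner ℝ a ξ) : ℂ)]
  congr 1
  refine MeasureTheory.integral_congr_ae (.of_forall fun v => ?_)
  simp only []
  rw [Circle.smul_def, Circle.smul_def, inner_add_left, neg_add, AddChar.map_add_eq_mul,
    inner_smul_left, inner_smul_right]
  simp
  ring

/-! ### Cutoffs and products of test functions -/

/-- A smooth bump function around `a`, equal to `1` on the ball of radius `r / 2` and supported in
the ball of radius `r`. -/
def cutoff (a : Euc d) (r : ℝ) (hr : 0 < r) : 𝓢(Euc d, ℂ) :=
  let b : ContDiffBump a := ⟨r / 2, r, half_pos hr, half_lt_self hr⟩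
  have h1 : HasCompactSupport (Complex.ofRealCLM ∘ b) := b.hasCompactSupport.comp_left rfl
  h1.toSchwartzMap (Complex.ofRealCLM.contDiff.comp b.contDiff)

theorem tsupport_cutoff_subset (a : Euc d) (r : ℝ) (hr : 0 < r) :
    tsupport (cutoff a r hr) ⊆ Metric.closedBall a r := by
  rw [← ContDiffBump.tsupport_eq (⟨r / 2, r, half_pos hr, half_lt_self hr⟩ : ContDiffBump a)]
  exact tsupport_comp_subset (g := Complex.ofRealCLM) rfl _

theorem cutoff_eq_one {a x : Euc d} {r : ℝ} (hr : 0 < r) (hx : x ∈ Metric.closedBall a (r / 2)) :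
    cutoff a r hr x = 1 := by
  change (((⟨r / 2, r, half_pos hr, half_lt_self hr⟩ : ContDiffBump a) x : ℝ) : ℂ) = 1
  rw [ContDiffBump.one_of_mem_closedBall _ hx, Complex.ofReal_one]

theorem cutoff_eventuallyEq_one (a : Euc d) (r : ℝ) (hr : 0 < r) :
    (cutoff a r hr : Euc d → ℂ) =ᶠ[nhds a] 1 := by
  filter_upwards [Metric.closedBall_mem_nhds a (half_pos hr)] with x hx
  exact cutoff_eq_one hr hx

theorem hasCompactSupport_of_tsupport_subset {φ : 𝓢(Euc d, ℂ)} {a : Euc d} {r : ℝ}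
    (h : tsupport φ ⊆ Metric.closedBall a r) : HasCompactSupport φ :=
  (isCompact_closedBall a r).of_isClosed_subset (isClosed_tsupport _) h

/-- The pointwise product of Schwartz functions. -/
def mulSchwartz (χ : 𝓢(Euc d, ℂ)) : 𝓢(Euc d, ℂ) →L[ℂ] 𝓢(Euc d, ℂ) := SchwartzMap.smulLeftCLM ℂ χ

theorem mulSchwartz_apply (χ φ : 𝓢(Euc d, ℂ)) (x : Euc d) : mulSchwartz χ φ x = χ x * φ x :=
  SchwartzMap.smulLeftCLM_apply_apply χ.hasTemperateGrowth _ _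

theorem tsupport_mulSchwartz_subset (χ φ : 𝓢(Euc d, ℂ)) :
    tsupport (mulSchwartz χ φ) ⊆ tsupport φ ∩ tsupport χ :=
  SchwartzMap.tsupport_smulLeftCLM_subset _ _

theorem fourier_apply_zero (φ : 𝓢(Euc d, ℂ)) : 𝓕 φ 0 = ∫ y, φ y := by
  rw [SchwartzMap.fourier_coe, Real.fourier_eq]
  simp

/-! ### Jets at a point and dual test functions -/

/-- A polynomial on `ℂ^d` which vanishes at the real points vanishes. -/
theorem _root_.MvPolynomial.eq_zero_of_eval_real {σ : Type*} {P : MvPolynomial σ ℂ}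
    (h : ∀ x : σ → ℝ, P.eval (fun i => (x i : ℂ)) = 0) : P = 0 := by
  refine MvPolynomial.funext_set (fun _ => Set.range ((↑) : ℝ → ℂ))
    (fun _ => Set.infinite_range_of_injective Complex.ofReal_injective) fun x hx => ?_
  choose y hy using fun i => hx i (Set.mem_univ i)
  rw [map_zero, ← h y]
  exact congrArg (fun z => MvPolynomial.eval z P) (funext fun i => (hy i).symm)

/-- Tested on Fourier transforms of θ, a linear relation becomes ∫ Pθ = 0 for a polynomial P whose
coefficients are those of the relation up to powers of 2πi. Hence P vanishes. -/
theorem dualDeriv_linearIndependent (S : Finset (Fin d → ℕ)) (c : (Fin d → ℕ) → ℂ)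
    (h : ∀ φ : 𝓢(Euc d, ℂ), ∑ k ∈ S, c k * dualDeriv k φ 0 = 0) : ∀ k ∈ S, c k = 0 := by
  set w : ℂ := 2 * Real.pi * Complex.I with hw
  have hw0 : w ≠ 0 := by simp [hw, Real.pi_ne_zero]
  let P : MvPolynomial (Fin d) ℂ :=
    ∑ k ∈ S, MvPolynomial.monomial (Finsupp.equivFunOnFinite.symm k) (c k * w ^ len k)
  have hP : ∀ y : Euc d, P.eval (fun i => (y i : ℂ)) = ∑ k ∈ S, c k * ∏ j, (w * (y j : ℂ)) ^ k j := by
    intro y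
    simp only [P, map_sum, MvPolynomial.eval_monomial]
    refine Finset.sum_congr rfl fun k _ => ?_
    rw [Finsupp.prod_fintype _ _ (by simp), mul_assoc, len, ← Finset.prod_pow_eq_pow_sum,
      ← Finset.prod_mul_distrib]
    simp [mul_pow]
  have hcont : Continuous fun y : Euc d => P.eval (fun i => (y i : ℂ)) := by
    simp only [hP]
    fun_prop
  have hae : ∀ᵐ y : Euc d, P.eval (fun i => (y i : ℂ)) = 0 := by
    refine ae_eq_zero_of_integral_contDiff_smul_eq_zero hcont.locallyIntegrable fun g hg hgs => ?_
    let θ : 𝓢(Euc d, ℂ) := HasCompactSupport.toSchwartzMap (f := fun x => (g x : ℂ))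
      (hgs.comp_left Complex.ofReal_zero) (Complex.ofRealCLM.contDiff.comp hg)
    have hθ := h (𝓕 θ)
    simp only [dualDeriv_fourier, fourier_apply_zero, ← MeasureTheory.integral_const_mul] at hθ
    rw [← MeasureTheory.integral_finsetSum _
      fun k _ => ((mulMonomial k θ).integrable (μ := MeasureTheory.volume)).const_mul (c k)] at hθ
    rw [← hθ]
    refine MeasureTheory.integral_congr_ae (.of_forall fun y => ?_)
    simp only [hP, mulMonomial_apply, Complex.real_smul, Finset.mul_sum]
    refine Finset.sum_congr rfl fun k _ => ?_
    rw [show θ y = (g y : ℂ) from rfl]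
    ring
  have hall := (Continuous.ae_eq_iff_eq (MeasureTheory.volume : MeasureTheory.Measure (Euc d))
    hcont continuous_const).1 hae
  have hP0 : P = 0 := MvPolynomial.eq_zero_of_eval_real fun x =>
    congrFun hall (WithLp.toLp 2 x)
  intro k hk
  have hcoeff := congrArg (MvPolynomial.coeff (Finsupp.equivFunOnFinite.symm k)) hP0
  simp only [P, MvPolynomial.coeff_sum, MvPolynomial.coeff_monomial, MvPolynomial.coeff_zero,
    EmbeddingLike.apply_eq_iff_eq, Finset.sum_ite_eq', hk, if_true] at hcoeff
  exact (mul_eq_zero.1 hcoeff).resolve_right (pow_ne_zero _ hw0)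

/-- Test functions dual to the derivatives at the origin. -/
theorem exists_dual_testFunction (S : Finset (Fin d → ℕ)) (m : Fin d → ℕ) :
    ∃ Φ : 𝓢(Euc d, ℂ), tsupport Φ ⊆ Metric.closedBall 0 (1 / 2) ∧
      ∀ k ∈ S, dualDeriv k Φ 0 = if k = m then 1 else 0 := by
  classical
  let L : 𝓢(Euc d, ℂ) →ₗ[ℂ] (S → ℂ) := LinearMap.pi fun k =>
    (TemperedDistribution.delta (0 : Euc d)).toLinearMap ∘ₗ (dualDeriv k.1).toLinearMap
  have hL : ∀ φ (k : S), L φ k = dualDeriv k.1 φ 0 := fun _ _ => rfl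
  -- A linear form killing the range of `L` is a linear relation between derivatives at 0, so
  -- independence gives surjectivity.
  have hsurj : Function.Surjective L := by
    rw [← LinearMap.dualMap_injective_iff, ← LinearMap.ker_eq_bot, LinearMap.ker_eq_bot']
    intro ℓ hℓ
    have h0 := dualDeriv_linearIndependent S
      (fun k => if hk : k ∈ S then ℓ (Pi.single ⟨k, hk⟩ 1) else 0) fun φ => by
        have := LinearMap.congr_fun hℓ φ
        rw [LinearMap.dualMap_apply, LinearMap.pi_apply_eq_sum_univ ℓ] at this
        rw [← Finset.sum_coe_sort]
        have hs : ∀ i : S, (fun j => if i = j then (1 : ℂ) else 0) = Pi.single i 1 := by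
          intro i
          ext j
          simp [Pi.single_apply, eq_comm]
        simpa [hL, mul_comm, hs] using this
    refine LinearMap.pi_ext' fun k => LinearMap.ext_ring ?_
    have := h0 k.1 k.2
    rw [dif_pos k.2] at this
    simpa using this
  obtain ⟨φ, hφ⟩ := hsurj fun k => if k.1 = m then 1 else 0
  -- The cutoff is 1 near 0 and so localises φ without changing its jet there.
  refine ⟨mulSchwartz (cutoff 0 (1 / 2) (by norm_num)) φ,
    (tsupport_mulSchwartz_subset _ _).trans
      (Set.inter_subset_right.trans (tsupport_cutoff_subset _ _ _)), fun k hk => ?_⟩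
  have := congrFun hφ ⟨k, hk⟩
  rw [hL] at this
  rw [← this]
  refine dualDeriv_congr ?_
  filter_upwards [cutoff_eventuallyEq_one (0 : Euc d) (1 / 2) (by norm_num)] with x hx
  rw [mulSchwartz_apply, hx, Pi.one_apply, one_mul]

/-! ### Growth under dilation controls the order and size of coefficients -/

/-- The finite set of multi-indices of length at most `N`. -/
def multiIndices (d N : ℕ) : Finset (Fin d → ℕ) :=
  (Fintype.piFinset fun _ => Finset.range (N + 1)).filter fun k => len k ≤ N

theorem mem_multiIndices {N : ℕ} {k : Fin d → ℕ} : k ∈ multiIndices d N ↔ len k ≤ N := by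
  simp only [multiIndices, Finset.mem_filter, Fintype.mem_piFinset, Finset.mem_range,
    and_iff_right_iff_imp]
  intro h i
  have : k i ≤ len k := Finset.single_le_sum (f := k) (fun _ _ => Nat.zero_le _) (Finset.mem_univ i)
  omega

/-- A continuous functional is bounded by finitely many Schwartz seminorms. -/
theorem exists_seminorm_bound (T : 𝓢'(Euc d, ℂ)) : ∃ (K : ℕ) (C : ℝ), 0 ≤ C ∧
    ∀ (φ : 𝓢(Euc d, ℂ)) (B : ℝ), 0 ≤ B →
      (∀ k ≤ K, ∀ n ≤ K, ∀ x, ‖x‖ ^ k * ‖iteratedFDeriv ℝ n φ x‖ ≤ B) → ‖T φ‖ ≤ C * B := by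
  obtain ⟨s, C, -, hC⟩ := Seminorm.bound_of_continuous (schwartz_withSeminorms ℂ (Euc d) ℂ)
    ((normSeminorm ℂ ℂ).comp T.toLinearMap) (by
      change Continuous fun φ => ‖T φ‖
      exact (map_continuous T).norm)
  refine ⟨s.sup fun m => max m.1 m.2, C, C.2, fun φ B hB h => ?_⟩
  refine (hC φ).trans ?_
  change (C : ℝ) * _ ≤ _
  gcongr
  refine Seminorm.finset_sup_apply_le hB fun m hm => ?_
  have hle : max m.1 m.2 ≤ s.sup fun m => max m.1 m.2 := Finset.le_sup (f := fun m => max m.1 m.2) hm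
  exact SchwartzMap.seminorm_le_bound ℂ _ _ _ hB
    (h _ ((le_max_left _ _).trans hle) _ ((le_max_right _ _).trans hle))

theorem iteratedFDeriv_rescale (a : Euc d) (ε : ℝ) (hε : 0 < ε) (φ : 𝓢(Euc d, ℂ)) (n : ℕ)
    (x : Euc d) : iteratedFDeriv ℝ n (rescale a ε hε φ) x =
      ε⁻¹ ^ n • iteratedFDeriv ℝ n φ (ε⁻¹ • (x - a)) := by
  have h1 : (rescale a ε hε φ : Euc d → ℂ) = fun x => (fun y => φ (ε⁻¹ • y)) (x - a) := rfl
  rw [h1, iteratedFDeriv_comp_sub (f := fun y => φ (ε⁻¹ • y)) n a x,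
    iteratedFDeriv_comp_const_smul _ (φ.smooth n)]

/-- The action of a tempered distribution on rescaled test functions grows at most polynomially. -/
theorem exists_rescale_bound (T : 𝓢'(Euc d, ℂ)) : ∃ K : ℕ, ∀ Φ : 𝓢(Euc d, ℂ),
    tsupport Φ ⊆ Metric.closedBall 0 (1 / 2) → ∃ C : ℝ, 0 ≤ C ∧ ∀ (a : Euc d) (ε : ℝ) (hε : 0 < ε),
      ε ≤ 1 → ‖T (rescale a ε hε Φ)‖ ≤ C * (1 + ‖a‖) ^ K * ε⁻¹ ^ K := by
  obtain ⟨K, C, hC, hT⟩ := exists_seminorm_bound T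
  refine ⟨K, fun Φ hΦ => ?_⟩
  let D : ℝ := ∑ n ∈ Finset.range (K + 1), SchwartzMap.seminorm ℂ 0 n Φ
  have hD : ∀ n ≤ K, ∀ x, ‖iteratedFDeriv ℝ n Φ x‖ ≤ D := fun n hn x =>
    (SchwartzMap.norm_iteratedFDeriv_le_seminorm ℂ Φ n x).trans
      (Finset.single_le_sum (f := fun n => SchwartzMap.seminorm ℂ 0 n Φ)
        (fun _ _ => apply_nonneg _ _) (Finset.mem_range.2 (by omega)))
  have hD0 : 0 ≤ D := (norm_nonneg _).trans (hD 0 (by omega) 0)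
  refine ⟨C * D, by positivity, fun a ε hε hε1 => ?_⟩
  rw [mul_assoc, mul_assoc]
  refine hT _ _ (by positivity) fun k hk n hn x => ?_
  have hinv : 1 ≤ ε⁻¹ := (one_le_inv₀ hε).2 hε1
  rw [iteratedFDeriv_rescale, norm_smul, norm_pow, norm_inv, Real.norm_of_nonneg hε.le]
  by_cases hx : ε⁻¹ • (x - a) ∈ tsupport Φ
  · have h1 : ‖x‖ ≤ 1 + ‖a‖ := by
      have := hΦ hx
      rw [mem_closedBall_zero_iff, norm_smul, norm_inv, Real.norm_of_nonneg hε.le,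
        inv_mul_le_iff₀ hε] at this
      have h2 : ‖x‖ ≤ ‖x - a‖ + ‖a‖ := by simpa using norm_add_le (x - a) a
      linarith
    calc ‖x‖ ^ k * (ε⁻¹ ^ n * ‖iteratedFDeriv ℝ n Φ (ε⁻¹ • (x - a))‖)
        ≤ (1 + ‖a‖) ^ k * (ε⁻¹ ^ n * D) := by gcongr; exact hD n hn _
      _ ≤ (1 + ‖a‖) ^ K * (ε⁻¹ ^ K * D) := by
        gcongr
        linarith [norm_nonneg a]
      _ = _ := by ring
  · have : iteratedFDeriv ℝ n Φ (ε⁻¹ • (x - a)) = 0 :=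
      image_eq_zero_of_notMem_tsupport fun h => hx (tsupport_iteratedFDeriv_subset n h)
    rw [this, norm_zero, mul_zero, mul_zero]
    positivity

theorem IsDeltaDerivSum.apply_eq {T : 𝓢'(Euc d, ℂ)} {A : Set (Euc d)}
    {p : Euc d → ((Fin d → ℕ) →₀ ℂ)} (hT : IsDeltaDerivSum T A p) {a : Euc d} (ha : a ∈ A)
    {φ : 𝓢(Euc d, ℂ)} (hc : HasCompactSupport φ) (h : A ∩ tsupport φ ⊆ {a}) :
    T φ = (p a).sum fun k c => c * dualDeriv k φ a := by
  refine (hT φ hc).unique ?_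
  have := hasSum_single (f := fun b : A => (p b).sum fun k c =>
    c * multiDeriv k (TemperedDistribution.delta (b : Euc d)) φ) ⟨a, ha⟩ fun b hb => by
      refine Finset.sum_eq_zero fun k _ => ?_
      have hb' : (b : Euc d) ∉ tsupport φ := fun hb' => hb (Subtype.ext (h ⟨b.2, hb'⟩))
      simp only [multiDeriv_apply, TemperedDistribution.delta_apply]
      rw [dualDeriv_apply_eq_zero hb', mul_zero]
  simpa only [multiDeriv_apply, TemperedDistribution.delta_apply] using this

/-- Isolation leaves only the point `a`, and duality only the index `m`; the chain rule supplies the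
power of ε. This identity is how every coefficient is read off. -/
theorem IsDeltaDerivSum.apply_rescale {T : 𝓢'(Euc d, ℂ)} {A : Set (Euc d)}
    {p : Euc d → ((Fin d → ℕ) →₀ ℂ)} (hT : IsDeltaDerivSum T A p) {a : Euc d} (ha : a ∈ A)
    {r : ℝ} (hr : A ∩ Metric.ball a r ⊆ {a}) {Φ : 𝓢(Euc d, ℂ)}
    (hΦ : tsupport Φ ⊆ Metric.closedBall 0 (1 / 2)) {m : Fin d → ℕ}
    (hm : ∀ k ∈ (p a).support, dualDeriv k Φ 0 = if k = m then 1 else 0)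
    {ε : ℝ} (hε : 0 < ε) (hεr : ε ≤ r) :
    T (rescale a ε hε Φ) = p a m * (ε : ℂ)⁻¹ ^ len m := by
  classical
  have hsupp := tsupport_rescale_subset (a := a) hε hΦ
  rw [hT.apply_eq ha (hasCompactSupport_of_tsupport_subset hsupp)]
  · simp only [dualDeriv_rescale, sub_self, smul_zero]
    rw [Finsupp.sum, Finset.sum_eq_single m]
    · by_cases h : m ∈ (p a).support
      · rw [hm m h, if_pos rfl, mul_one]
      · rw [Finsupp.notMem_support_iff.1 h, zero_mul, zero_mul]
    · intro k hk hkm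
      rw [hm k hk, if_neg hkm, mul_zero, mul_zero]
    · intro h
      rw [Finsupp.notMem_support_iff.1 h, zero_mul]
  · refine subset_trans (Set.inter_subset_inter_right _ (hsupp.trans ?_)) hr
    exact Metric.closedBall_subset_ball (by linarith)

/-- If a distribution grows at most like `ε⁻ᴺ` on test functions rescaled around `a`, then its
order at `a` is at most `N`. -/
theorem eq_zero_of_norm_le_mul {z : ℂ} {C : ℝ} {e : ℝ} (he : 0 < e)
    (h : ∀ ε : ℝ, 0 < ε → ε ≤ e → ‖z‖ ≤ C * ε) : z = 0 := by
  have hlim : Filter.Tendsto (fun ε : ℝ => C * ε) (nhdsWithin 0 (Set.Ioi 0)) (nhds 0) := by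
    have : Filter.Tendsto (fun ε : ℝ => C * ε) (nhds 0) (nhds (C * 0)) :=
      (continuous_const.mul continuous_id).tendsto 0
    rw [mul_zero] at this
    exact this.mono_left nhdsWithin_le_nhds
  have := ge_of_tendsto hlim (b := ‖z‖) (by
    filter_upwards [Ioc_mem_nhdsGT he] with ε hε
    exact h ε hε.1 hε.2)
  exact norm_le_zero_iff.1 this

/-- The dual test function gives ‖p a m‖ ε^(-len m) ≤ C ε^(-N) with len m > N, hence ‖p a m‖ ≤ Cε
for all small ε. -/
theorem IsDeltaDerivSum.coeff_eq_zero {T : 𝓢'(Euc d, ℂ)} {A : Set (Euc d)}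
    {p : Euc d → ((Fin d → ℕ) →₀ ℂ)} (hT : IsDeltaDerivSum T A p) {a : Euc d} (ha : a ∈ A)
    {r : ℝ} (hr0 : 0 < r) (hr : A ∩ Metric.ball a r ⊆ {a}) {N : ℕ}
    (hbound : ∀ Φ : 𝓢(Euc d, ℂ), tsupport Φ ⊆ Metric.closedBall 0 (1 / 2) → ∃ C : ℝ,
      ∀ (ε : ℝ) (hε : 0 < ε), ε ≤ 1 → ‖T (rescale a ε hε Φ)‖ ≤ C * ε⁻¹ ^ N)
    {m : Fin d → ℕ} (hm : N < len m) : p a m = 0 := by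
  obtain ⟨Φ, hΦ, hdual⟩ := exists_dual_testFunction (p a).support m
  obtain ⟨C, hC⟩ := hbound Φ hΦ
  refine eq_zero_of_norm_le_mul (C := C) (lt_min hr0 one_pos) fun ε hε hεr => ?_
  have h1 := hC ε hε (hεr.trans (min_le_right _ _))
  rw [hT.apply_rescale ha hr hΦ hdual hε (hεr.trans (min_le_left _ _)), norm_mul, norm_pow,
    norm_inv, Complex.norm_real, Real.norm_of_nonneg hε.le] at h1
  have h2 : ε⁻¹ ^ (N + 1) ≤ ε⁻¹ ^ len m :=
    pow_le_pow_right₀ ((one_le_inv₀ hε).2 (hεr.trans (min_le_right _ _))) hm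
  have h3 : ‖p a m‖ * ε⁻¹ ^ (N + 1) ≤ C * ε⁻¹ ^ N :=
    (mul_le_mul_of_nonneg_left h2 (norm_nonneg _)).trans h1
  have h4 : 0 < ε⁻¹ ^ (N + 1) := by positivity
  refine le_of_mul_le_mul_right (h3.trans_eq ?_) h4
  rw [pow_succ, mul_assoc, mul_comm (ε⁻¹ ^ N), mul_inv_cancel_left₀ hε.ne']

theorem IsLocallyFinite.exists_isolating {A : Set (Euc d)} (hA : IsLocallyFinite A) (a : Euc d) :
    ∃ r > 0, A ∩ Metric.ball a r ⊆ {a} := by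
  have hfin := hA a 1
  have : ((A ∩ Metric.ball a 1) \ {a})ᶜ ∈ nhds a :=
    ((hfin.subset Set.sdiff_subset).isClosed.isOpen_compl).mem_nhds (by simp)
  obtain ⟨r, hr0, hr⟩ := Metric.mem_nhds_iff.1 this
  refine ⟨min r 1, lt_min hr0 one_pos, fun x hx => ?_⟩
  by_contra hxa
  exact hr (Metric.ball_subset_ball (min_le_left _ _) hx.2)
    ⟨⟨hx.1, Metric.ball_subset_ball (min_le_right _ _) hx.2⟩, hxa⟩

/-- The radius depends only on the lower bound `e`, so one radius serves all the spectra Γ_k at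
once. -/
theorem exists_isolating_of_le_sepConst {e : ENNReal} (he : 0 < e) :
    ∃ r > 0, r ≤ 1 ∧ ∀ A : Set (Euc d), e ≤ sepConst A → ∀ a ∈ A, A ∩ Metric.ball a r ⊆ {a} := by
  obtain ⟨s, hs0, hs⟩ : ∃ s : NNReal, 0 < s ∧ (s : ENNReal) < e := by
    obtain ⟨s, h1, h2⟩ := ENNReal.lt_iff_exists_nnreal_btwn.1 he
    exact ⟨s, by simpa using h1, h2⟩
  refine ⟨min s 1, lt_min (by simpa using hs0) one_pos, min_le_right _ _, fun A hA a ha x hx => ?_⟩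
  by_contra hxa
  have h1 := hs.trans_le (hA.trans (Set.einfsep_le_edist_of_mem hx.1 ha hxa))
  rw [edist_nndist, ENNReal.coe_lt_coe, ← NNReal.coe_lt_coe, coe_nndist] at h1
  exact absurd (hx.2.trans_le (min_le_left _ _)) (not_lt.2 h1.le)

/-- A tempered distribution with locally finite support has finite order. -/
theorem IsDeltaDerivSum.exists_order_growth {T : 𝓢'(Euc d, ℂ)} {A : Set (Euc d)}
    {p : Euc d → ((Fin d → ℕ) →₀ ℂ)} (hT : IsDeltaDerivSum T A p) (hA : IsLocallyFinite A) :
    ∃ K : ℕ, (∀ a ∈ A, ∀ m, K < len m → p a m = 0) ∧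
      (IsUniformlyDiscrete A → ∃ C : ℝ, ∀ m, ∀ a ∈ A, ‖p a m‖ ≤ C * (1 + ‖a‖) ^ K) := by
  obtain ⟨K, hK⟩ := exists_rescale_bound T
  have hord : ∀ a ∈ A, ∀ m, K < len m → p a m = 0 := by
    intro a ha m hm
    obtain ⟨r, hr0, hr⟩ := hA.exists_isolating a
    refine hT.coeff_eq_zero ha hr0 hr (fun Φ hΦ => ?_) hm
    obtain ⟨C, -, hC⟩ := hK Φ hΦ
    -- The factor (1+‖a‖)^K is independent of ε and joins the constant, so the same order bound
    -- holds at every point.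
    exact ⟨_, fun ε hε hε1 => hC a ε hε hε1⟩
  refine ⟨K, hord, fun hud => ?_⟩
  obtain ⟨r, hr0, hr1, hr⟩ := exists_isolating_of_le_sepConst (d := d) hud.2
  replace hr := hr A le_rfl
  choose Φ hΦ hdual using exists_dual_testFunction (multiIndices d K)
  choose C hC0 hC using fun m => hK (Φ m) (hΦ m)
  refine ⟨∑ m ∈ multiIndices d K, C m * r⁻¹ ^ K, fun m a ha => ?_⟩
  have hsum0 : ∀ m, 0 ≤ C m * r⁻¹ ^ K := fun m => by have := hC0 m; positivity
  by_cases hm : len m ≤ K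
  -- Taking ε equal to the common isolation radius turns the growth estimate into a bound for the
  -- coefficient.
  · have h1 := hC m a r hr0 hr1
    rw [hT.apply_rescale ha (hr a ha) (hΦ m) (fun k hk => hdual m k ?_) hr0 le_rfl, norm_mul,
      norm_pow, norm_inv, Complex.norm_real, Real.norm_of_nonneg hr0.le] at h1
    · have h2 : 1 ≤ r⁻¹ ^ len m := one_le_pow₀ ((one_le_inv₀ hr0).2 hr1)
      calc ‖p a m‖ ≤ ‖p a m‖ * r⁻¹ ^ len m := le_mul_of_one_le_right (norm_nonneg _) h2
        _ ≤ C m * (1 + ‖a‖) ^ K * r⁻¹ ^ K := h1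
        _ = C m * r⁻¹ ^ K * (1 + ‖a‖) ^ K := by ring
        _ ≤ _ := by
          gcongr
          exact Finset.single_le_sum (f := fun m => C m * r⁻¹ ^ K) (fun m _ => hsum0 m)
            (mem_multiIndices.2 hm)
    · rw [mem_multiIndices]
      by_contra hlt
      exact Finsupp.mem_support_iff.1 hk (hord a ha k (not_le.1 hlt))
  · rw [hord a ha m (not_le.1 hm), norm_zero]
    exact mul_nonneg (Finset.sum_nonneg fun m _ => hsum0 m) (by positivity)

/-- Uniform version of `IsDeltaDerivSum.coeff_eq_zero`: bounds for the coefficients which depend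
only on the growth on rescaled test functions and on the radius of isolation. -/
theorem exists_coeff_bound {N : ℕ} {r : ℝ} (hr0 : 0 < r) (hr1 : r ≤ 1)
    (B : 𝓢(Euc d, ℂ) → ℝ) : ∃ C : ℝ, ∀ (T : 𝓢'(Euc d, ℂ)) (A : Set (Euc d))
      (p : Euc d → ((Fin d → ℕ) →₀ ℂ)), IsDeltaDerivSum T A p →
      (∀ a ∈ A, A ∩ Metric.ball a r ⊆ {a}) →
      (∀ Φ : 𝓢(Euc d, ℂ), tsupport Φ ⊆ Metric.closedBall 0 (1 / 2) → ∀ (a : Euc d) (ε : ℝ)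
        (hε : 0 < ε), ε ≤ 1 → ‖T (rescale a ε hε Φ)‖ ≤ B Φ * ε⁻¹ ^ N) →
      ∀ a ∈ A, ∀ m, (p a m ≠ 0 → len m ≤ N) ∧ ‖p a m‖ ≤ C := by
  choose Φ hΦ hdual using exists_dual_testFunction (multiIndices d N)
  refine ⟨∑ m ∈ multiIndices d N, |B (Φ m)| * r⁻¹ ^ N, fun T A p hT hr hB a ha => ?_⟩
  have hord : ∀ m, p a m ≠ 0 → len m ≤ N := fun m hm => by
    by_contra hlt
    exact hm (hT.coeff_eq_zero ha hr0 (hr a ha)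
      (fun Φ hΦ => ⟨B Φ, fun ε hε hε1 => hB Φ hΦ a ε hε hε1⟩) (not_le.1 hlt))
  refine fun m => ⟨hord m, ?_⟩
  have hsum0 : ∀ m, 0 ≤ |B (Φ m)| * r⁻¹ ^ N := fun m => by positivity
  by_cases hm : len m ≤ N
  · have h1 := hB (Φ m) (hΦ m) a r hr0 hr1
    rw [hT.apply_rescale ha (hr a ha) (hΦ m) (fun k hk => hdual m k
      (mem_multiIndices.2 (hord k (Finsupp.mem_support_iff.1 hk)))) hr0 le_rfl, norm_mul,
      norm_pow, norm_inv, Complex.norm_real, Real.norm_of_nonneg hr0.le] at h1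
    have h2 : 1 ≤ r⁻¹ ^ len m := one_le_pow₀ ((one_le_inv₀ hr0).2 hr1)
    calc ‖p a m‖ ≤ ‖p a m‖ * r⁻¹ ^ len m := le_mul_of_one_le_right (norm_nonneg _) h2
      _ ≤ B (Φ m) * r⁻¹ ^ N := h1
      _ ≤ |B (Φ m)| * r⁻¹ ^ N := by gcongr; exact le_abs_self _
      _ ≤ _ := Finset.single_le_sum (f := fun m => |B (Φ m)| * r⁻¹ ^ N) (fun m _ => hsum0 m)
            (mem_multiIndices.2 hm)
  · have : p a m = 0 := by
      by_contra h
      exact hm (hord m h)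
    rw [this, norm_zero]
    exact Finset.sum_nonneg fun m _ => hsum0 m

/-! ### Sums over sets of bounded density -/

theorem IsLocallyFinite.countable {A : Set (Euc d)} (hA : IsLocallyFinite A) : A.Countable := by
  have : A = ⋃ n : ℕ, A ∩ Metric.ball 0 n := by
    rw [← Set.inter_iUnion, Metric.iUnion_ball_nat, Set.inter_univ]
  rw [this]
  exact Set.countable_iUnion fun n => (hA 0 n).countable

open MeasureTheory in
theorem lintegral_comp_smul_euc (g : Euc d → ENNReal) {ε : ℝ} (hε : 0 < ε) :
    ∫⁻ x, g (ε • x) = ENNReal.ofReal (ε⁻¹ ^ d) * ∫⁻ x, g x := by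
  have he := (Homeomorph.smulOfNeZero ε hε.ne' : Euc d ≃ₜ Euc d).measurableEmbedding
  have h1 : ∫⁻ x, g (ε • x) = ∫⁻ x, g x ∂(Measure.map (ε • ·) (volume : Measure (Euc d))) :=
    (he.lintegral_map _).symm
  rw [h1, Measure.map_addHaar_smul _ hε.ne', lintegral_smul_measure, finrank_euclideanSpace,
    Fintype.card_fin, smul_eq_mul, abs_of_pos (by positivity), inv_pow]

open MeasureTheory in
-- Each term is dominated by an average over the unit ball around its point. These balls overlap at
-- most N times, so the sum is controlled by an integral, and dilating that integral produces
-- ε^(-d). The exponent d + 1 makes it converge.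
theorem HasBoundedDensity.exists_tsum_le {A : Set (Euc d)} (hA : HasBoundedDensity A) :
    ∃ C : ℝ, 0 ≤ C ∧ ∀ ε : ℝ, 0 < ε → ε ≤ 1 →
      Summable (fun a : A => ((1 + ε * ‖(a : Euc d)‖) ^ (d + 1))⁻¹) ∧
      ∑' a : A, ((1 + ε * ‖(a : Euc d)‖) ^ (d + 1))⁻¹ ≤ C * ε⁻¹ ^ d := by
  obtain ⟨hlf, N, hN⟩ := hA
  have : Countable A := hlf.countable
  let g : Euc d → ENNReal := fun x => ENNReal.ofReal ((1 + ‖x‖) ^ (d + 1))⁻¹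
  have hgm : Measurable g := by fun_prop
  have hg : ∫⁻ x, g x < ⊤ := by
    have := finite_integral_one_add_norm (E := Euc d) (μ := volume) (r := (d + 1 : ℕ))
      (by rw [finrank_euclideanSpace, Fintype.card_fin]; push_cast; linarith)
    convert this using 3 with x
    rw [Real.rpow_neg (by positivity), Real.rpow_natCast]
  set v := volume (Metric.ball (0 : Euc d) 1) with hv
  have hv0 : v ≠ 0 := (Metric.measure_ball_pos _ _ one_pos).ne'
  have hvt : v ≠ ⊤ := measure_ball_lt_top.ne
  have hball : ∀ a : Euc d, volume (Metric.ball a 1) = v := fun a =>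
    Measure.addHaar_ball_center _ a 1
  set I := ∫⁻ x, g x with hI
  have key : ∀ ε : ℝ, 0 < ε → ε ≤ 1 → ∑' a : A, g (ε • (a : Euc d)) ≤
      v⁻¹ * (2 ^ (d + 1) * (N * (ENNReal.ofReal (ε⁻¹ ^ d) * I))) := by
    intro ε hε hε1
    -- The factor 2 per power comes from 1 + ε‖x‖ ≤ 2(1 + ε‖a‖) when ‖x - a‖ < 1 and ε ≤ 1.
    have h1 : ∀ a x : Euc d, x ∈ Metric.ball a 1 → g (ε • a) ≤ 2 ^ (d + 1) * g (ε • x) := by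
      intro a x hx
      have h2 : (2 : ENNReal) ^ (d + 1) = ENNReal.ofReal (2 ^ (d + 1)) := by
        rw [ENNReal.ofReal_pow (by norm_num)]; simp
      rw [h2, ← ENNReal.ofReal_mul (by positivity)]
      apply ENNReal.ofReal_le_ofReal
      rw [← inv_inv ((2 : ℝ) ^ (d + 1)), ← mul_inv]
      apply inv_anti₀ (by positivity)
      rw [← inv_pow, ← mul_pow]
      gcongr
      rw [norm_smul, norm_smul, Real.norm_of_nonneg hε.le]
      have h3 : ‖x‖ ≤ 1 + ‖a‖ := by
        have := norm_add_le (x - a) a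
        rw [sub_add_cancel] at this
        have h4 := mem_ball_iff_norm.1 hx
        linarith
      nlinarith [norm_nonneg a, norm_nonneg x]
    have h2 : ∀ a : A, v * g (ε • (a : Euc d)) ≤
        ∫⁻ x, (Metric.ball (a : Euc d) 1).indicator (fun x => 2 ^ (d + 1) * g (ε • x)) x := by
      intro a
      rw [lintegral_indicator measurableSet_ball, ← hball a, mul_comm, ← setLIntegral_const]
      exact setLIntegral_mono' measurableSet_ball fun x hx => h1 a x hx
    have h3 : ∀ x : Euc d, ∑' a : A, (Metric.ball (a : Euc d) 1).indicator
        (fun x => 2 ^ (d + 1) * g (ε • x)) x ≤ N * (2 ^ (d + 1) * g (ε • x)) := by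
      intro x
      have hfin := hlf x 1
      have : ∀ a : A, (Metric.ball (a : Euc d) 1).indicator (fun x => 2 ^ (d + 1) * g (ε • x)) x =
          (Metric.ball x 1).indicator (fun _ => 2 ^ (d + 1) * g (ε • x)) (a : Euc d) := by
        intro a
        by_cases h : x ∈ Metric.ball (a : Euc d) 1
        · rw [Set.indicator_of_mem h, Set.indicator_of_mem (Metric.mem_ball_comm.1 h)]
        · rw [Set.indicator_of_notMem h,
            Set.indicator_of_notMem fun h' => h (Metric.mem_ball_comm.1 h')]
      simp only [this]
      rw [tsum_subtype A ((Metric.ball x 1).indicator fun _ => 2 ^ (d + 1) * g (ε • x)),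
        Set.indicator_indicator, ← tsum_subtype, ENNReal.tsum_const]
      gcongr
      rw [ENat.card_coe_set_eq, ← hfin.cast_ncard_eq]
      exact_mod_cast hN x
    have hgε : Measurable fun x : Euc d => g (ε • x) := hgm.comp (measurable_const_smul ε)
    have hm : Measurable fun x : Euc d => 2 ^ (d + 1) * g (ε • x) := hgε.const_mul _
    rw [← ENNReal.mul_le_iff_le_inv hv0 hvt, ← ENNReal.tsum_mul_left]
    refine (ENNReal.tsum_le_tsum h2).trans ?_
    rw [← lintegral_tsum fun a => (hm.indicator measurableSet_ball).aemeasurable]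
    refine (lintegral_mono h3).trans_eq ?_
    rw [lintegral_const_mul _ hm, lintegral_const_mul _ hgε,
      lintegral_comp_smul_euc g hε]
    ring
  refine ⟨(v⁻¹ * (2 ^ (d + 1) * (N * I))).toReal, ENNReal.toReal_nonneg, fun ε hε hε1 => ?_⟩
  have hfin : v⁻¹ * (2 ^ (d + 1) * (N * I)) ≠ ⊤ :=
    ENNReal.mul_ne_top (ENNReal.inv_ne_top.2 hv0) (ENNReal.mul_ne_top (by simp)
      (ENNReal.mul_ne_top (by simp) hg.ne))
  have hgε : ∀ a : Euc d, (g (ε • a)) = ENNReal.ofReal ((1 + ε * ‖a‖) ^ (d + 1))⁻¹ := fun a => by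
    simp only [g, norm_smul, Real.norm_of_nonneg hε.le]
  have hle : ∑' a : A, ENNReal.ofReal ((1 + ε * ‖(a : Euc d)‖) ^ (d + 1))⁻¹ ≤
      ENNReal.ofReal (ε⁻¹ ^ d) * (v⁻¹ * (2 ^ (d + 1) * (N * I))) := by
    simp only [← hgε]
    exact (key ε hε hε1).trans_eq (by ring)
  have htop : ∑' a : A, ENNReal.ofReal ((1 + ε * ‖(a : Euc d)‖) ^ (d + 1))⁻¹ ≠ ⊤ :=
    ne_top_of_le_ne_top (ENNReal.mul_ne_top ENNReal.ofReal_ne_top hfin) hle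
  have hnn : ∀ a : A, 0 ≤ ((1 + ε * ‖(a : Euc d)‖) ^ (d + 1))⁻¹ := fun a => by positivity
  have hs : Summable (fun a : A => ((1 + ε * ‖(a : Euc d)‖) ^ (d + 1))⁻¹) := by
    have := ENNReal.summable_toReal htop
    simpa only [ENNReal.toReal_ofReal (hnn _)] using this
  refine ⟨hs, ?_⟩
  rw [← ENNReal.ofReal_tsum_of_nonneg hnn hs] at hle
  have := ENNReal.toReal_mono (ENNReal.mul_ne_top ENNReal.ofReal_ne_top hfin) hle
  rwa [ENNReal.toReal_ofReal (tsum_nonneg hnn), ENNReal.toReal_mul,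
    ENNReal.toReal_ofReal (by positivity), mul_comm] at this

theorem exists_decay (φ : 𝓢(Euc d, ℂ)) (n : ℕ) : ∃ D : ℝ, ∀ x, (1 + ‖x‖) ^ n * ‖φ x‖ ≤ D :=
  ⟨_, fun x => by
    have := SchwartzMap.one_add_le_sup_seminorm_apply (𝕜 := ℂ) (m := (n, 0)) (k := n) (n := 0)
      le_rfl le_rfl φ x
    rwa [norm_iteratedFDeriv_zero] at this⟩

/-- Since 1 + t ≤ ε⁻¹(1 + εt), the growth of `c` costs ε^(-N) and is absorbed by the decay of φ. The
constant `C'` is chosen before `c` and φ, which later gives uniformity in k. -/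
theorem HasBoundedDensity.exists_weighted_tsum_le {A : Set (Euc d)} (hA : HasBoundedDensity A) :
    ∃ C' : ℝ, 0 ≤ C' ∧ ∀ (N : ℕ) (C D : ℝ) (c φ : Euc d → ℂ),
      (∀ a ∈ A, ‖c a‖ ≤ C * (1 + ‖a‖) ^ N) → (∀ x, (1 + ‖x‖) ^ (N + (d + 1)) * ‖φ x‖ ≤ D) →
      ∀ ε : ℝ, 0 < ε → ε ≤ 1 →
        Summable (fun a : A => ‖c a * φ (ε • (a : Euc d))‖) ∧
        ∑' a : A, ‖c a * φ (ε • (a : Euc d))‖ ≤ |C| * |D| * C' * ε⁻¹ ^ N * ε⁻¹ ^ d := by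
  obtain ⟨C', hC', h⟩ := hA.exists_tsum_le
  refine ⟨C', hC', fun N C D c φ hc hφ ε hε hε1 => ?_⟩
  obtain ⟨hs, hle⟩ := h ε hε hε1
  have hb : ∀ a : A, ‖c a * φ (ε • (a : Euc d))‖ ≤
      |C| * |D| * ε⁻¹ ^ N * ((1 + ε * ‖(a : Euc d)‖) ^ (d + 1))⁻¹ := by
    intro a
    have h1 := hc a a.2
    have h2 := hφ (ε • (a : Euc d))
    rw [norm_smul, Real.norm_of_nonneg hε.le] at h2
    set t := ‖(a : Euc d)‖ with ht
    have ht0 : 0 ≤ t := norm_nonneg _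
    have h3 : 1 + t ≤ ε⁻¹ * (1 + ε * t) := by
      rw [mul_add, inv_mul_cancel_left₀ hε.ne', mul_one]
      have := (one_le_inv₀ hε).2 hε1
      linarith
    have hp : 0 < (1 + ε * t) ^ (d + 1) := by positivity
    rw [norm_mul, ← div_eq_mul_inv, le_div_iff₀ hp]
    calc ‖c a‖ * ‖φ (ε • (a : Euc d))‖ * (1 + ε * t) ^ (d + 1)
        ≤ (|C| * (1 + t) ^ N) * ‖φ (ε • (a : Euc d))‖ * (1 + ε * t) ^ (d + 1) := by
          gcongr
          exact h1.trans (by gcongr; exact le_abs_self C)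
      _ ≤ (|C| * (ε⁻¹ * (1 + ε * t)) ^ N) * ‖φ (ε • (a : Euc d))‖ * (1 + ε * t) ^ (d + 1) := by
          gcongr
      _ = |C| * ε⁻¹ ^ N * ((1 + ε * t) ^ (N + (d + 1)) * ‖φ (ε • (a : Euc d))‖) := by
          rw [mul_pow, pow_add]; ring
      _ ≤ |C| * ε⁻¹ ^ N * |D| := by
          gcongr
          exact h2.trans (le_abs_self D)
      _ = _ := by ring
  have hs' := hs.mul_left (|C| * |D| * ε⁻¹ ^ N)
  have hsum := Summable.of_nonneg_of_le (fun _ => norm_nonneg _) hb hs'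
  refine ⟨hsum, (hsum.tsum_le_tsum hb hs').trans ?_⟩
  rw [tsum_mul_left]
  calc _ ≤ |C| * |D| * ε⁻¹ ^ N * (C' * ε⁻¹ ^ d) := by gcongr
    _ = _ := by ring

/-- A family of point masses of polynomial growth on a set of bounded density defines a tempered
distribution. -/
theorem HasBoundedDensity.exists_distribution {A : Set (Euc d)} (hA : HasBoundedDensity A)
    {c : Euc d → ℂ} {C : ℝ} {N : ℕ} (hc : ∀ a ∈ A, ‖c a‖ ≤ C * (1 + ‖a‖) ^ N) :
    ∃ μ : 𝓢'(Euc d, ℂ), ∀ φ : 𝓢(Euc d, ℂ), Summable (fun a : A => ‖c a * φ a‖) ∧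
      HasSum (fun a : A => c a * φ a) (μ φ) := by
  obtain ⟨C', hC', h⟩ := hA.exists_weighted_tsum_le
  have hbound : ∀ (φ : 𝓢(Euc d, ℂ)) (D : ℝ), (∀ x, (1 + ‖x‖) ^ (N + (d + 1)) * ‖φ x‖ ≤ D) →
      Summable (fun a : A => ‖c a * φ a‖) ∧ ∑' a : A, ‖c a * φ a‖ ≤ |C| * |D| * C' := by
    intro φ D hD
    simpa using h N C D c φ hc hD 1 one_pos le_rfl
  have hsum : ∀ φ : 𝓢(Euc d, ℂ), Summable (fun a : A => ‖c a * φ a‖) := fun φ => by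
    obtain ⟨D, hD⟩ := exists_decay φ (N + (d + 1))
    exact (hbound φ D hD).1
  have hsum' : ∀ φ : 𝓢(Euc d, ℂ), Summable (fun a : A => c a * φ a) := fun φ => (hsum φ).of_norm
  let μ : 𝓢(Euc d, ℂ) →L[ℂ] ℂ := SchwartzMap.mkCLMtoNormedSpace (fun φ => ∑' a : A, c a * φ a)
    (fun φ ψ => by
      simp only [add_apply, mul_add]
      exact (hsum' φ).tsum_add (hsum' ψ))
    (fun z φ => by
      simp only [smul_apply, smul_eq_mul, RingHom.id_apply, mul_left_comm _ z]
      exact tsum_mul_left)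
    (by
      refine ⟨Finset.Iic (N + (d + 1), 0), |C| * 2 ^ (N + (d + 1)) * C', by positivity,
        fun φ => ?_⟩
      set q := (Finset.Iic (N + (d + 1), 0)).sup (schwartzSeminormFamily ℂ (Euc d) ℂ) φ with hq
      have hq0 : 0 ≤ q := apply_nonneg _ _
      have := hbound φ (2 ^ (N + (d + 1)) * q) fun x => by
        have := SchwartzMap.one_add_le_sup_seminorm_apply (𝕜 := ℂ) (m := (N + (d + 1), 0))
          (k := N + (d + 1)) (n := 0) le_rfl le_rfl φ x
        rwa [norm_iteratedFDeriv_zero] at this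
      refine (norm_tsum_le_tsum_norm this.1).trans (this.2.trans_eq ?_)
      rw [abs_of_nonneg (show 0 ≤ 2 ^ (N + (d + 1)) * q by positivity)]
      ring)
  exact ⟨ContinuousLinearMap.toPointwiseConvergenceCLM _ _ _ _ μ, fun φ => ⟨hsum φ, (hsum' φ).hasSum⟩⟩

/-- The factor ε^d from the transform of a dilation cancels the ε^(-d) from counting points, leaving
exactly the growth exponent of the masses; translating the test function only adds phases. `B` is
chosen before `c`, hence is common to all μ_k. -/
theorem HasBoundedDensity.exists_fourier_rescale_bound {A : Set (Euc d)}
    (hA : HasBoundedDensity A) (C : ℝ) (N : ℕ) : ∃ B : 𝓢(Euc d, ℂ) → ℝ,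
    ∀ (c : Euc d → ℂ) (μ : 𝓢'(Euc d, ℂ)), (∀ a ∈ A, ‖c a‖ ≤ C * (1 + ‖a‖) ^ N) →
      (∀ φ : 𝓢(Euc d, ℂ), HasSum (fun a : A => c a * φ a) (μ φ)) →
      ∀ (Φ : 𝓢(Euc d, ℂ)) (x : Euc d) (ε : ℝ) (hε : 0 < ε), ε ≤ 1 →
        ‖𝓕 μ (rescale x ε hε Φ)‖ ≤ B Φ * ε⁻¹ ^ N := by
  obtain ⟨C', hC', h⟩ := hA.exists_weighted_tsum_le
  choose D hD using fun φ : 𝓢(Euc d, ℂ) => exists_decay φ (N + (d + 1))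
  refine ⟨fun Φ => |C| * |D (𝓕 Φ)| * C', fun c μ hc hμ Φ x ε hε hε1 => ?_⟩
  obtain ⟨hs, hle⟩ := h N C _ c (𝓕 Φ : 𝓢(Euc d, ℂ)) hc (hD (𝓕 Φ)) ε hε hε1
  rw [TemperedDistribution.fourier_apply, ← (hμ _).tsum_eq]
  have hn : ∀ a : A, ‖c a * 𝓕 (rescale x ε hε Φ) a‖ = ε ^ d * ‖c a * 𝓕 Φ (ε • (a : Euc d))‖ := by
    intro a
    rw [fourier_rescale, norm_mul, norm_mul, norm_mul, norm_mul, norm_pow, Complex.norm_real,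
      Real.norm_of_nonneg hε.le, Circle.norm_coe]
    ring
  refine (norm_tsum_le_tsum_norm ?_).trans ?_
  · simp only [hn]
    exact hs.mul_left _
  · simp only [hn]
    rw [tsum_mul_left]
    calc _ ≤ ε ^ d * (|C| * |D (𝓕 Φ)| * C' * ε⁻¹ ^ N * ε⁻¹ ^ d) := by gcongr
      _ = |C| * |D (𝓕 Φ)| * C' * ε⁻¹ ^ N * (ε ^ d * ε⁻¹ ^ d) := by ring
      _ = _ := by rw [← mul_pow, mul_inv_cancel₀ hε.ne', one_pow, mul_one]

/-! ### Distributions with locally finite support -/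

theorem norm_iteratedFDeriv_mulSchwartz_le (χ φ : 𝓢(Euc d, ℂ)) (n : ℕ) (x : Euc d) :
    ‖iteratedFDeriv ℝ n (mulSchwartz χ φ) x‖ ≤ ∑ i ∈ Finset.range (n + 1),
      (n.choose i : ℝ) * ‖iteratedFDeriv ℝ i χ x‖ * ‖iteratedFDeriv ℝ (n - i) φ x‖ := by
  have h : (mulSchwartz χ φ : Euc d → ℂ) = fun x => χ x * φ x :=
    funext fun x => mulSchwartz_apply χ φ x
  rw [h]
  exact norm_iteratedFDeriv_mul_le (χ.smooth n) (φ.smooth n) x le_rfl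

/-- A bound for all seminorms of order up to `K`. -/
theorem exists_uniform_seminorm_bound (φ : 𝓢(Euc d, ℂ)) (K : ℕ) : ∃ B : ℝ, 0 ≤ B ∧
    ∀ k ≤ K, ∀ n ≤ K, ∀ x, ‖x‖ ^ k * ‖iteratedFDeriv ℝ n φ x‖ ≤ B := by
  refine ⟨∑ m ∈ Finset.range (K + 1) ×ˢ Finset.range (K + 1), SchwartzMap.seminorm ℂ m.1 m.2 φ,
    Finset.sum_nonneg fun _ _ => apply_nonneg _ _, fun k hk n hn x => ?_⟩
  refine (SchwartzMap.le_seminorm ℂ k n φ x).trans ?_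
  exact Finset.single_le_sum (f := fun m : ℕ × ℕ => SchwartzMap.seminorm ℂ m.1 m.2 φ)
    (fun _ _ => apply_nonneg _ _) (a := (k, n)) (by simp; omega)

/-- Test functions with compact support are dense: a tempered distribution which vanishes on them
vanishes. -/
theorem eq_zero_of_forall_hasCompactSupport {T : 𝓢'(Euc d, ℂ)}
    (hT : ∀ φ : 𝓢(Euc d, ℂ), HasCompactSupport φ → T φ = 0) (φ : 𝓢(Euc d, ℂ)) : T φ = 0 := by
  obtain ⟨K, C, hC, hK⟩ := exists_seminorm_bound T
  obtain ⟨S, hS0, hS⟩ := exists_uniform_seminorm_bound φ (K + 1)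
  let χ : 𝓢(Euc d, ℂ) := cutoff 0 1 one_pos
  obtain ⟨G, hG0, hG⟩ := exists_uniform_seminorm_bound χ K
  refine eq_zero_of_norm_le_mul (C := C * (2 * (S + 2 ^ K * G * S))) one_pos fun ε hε hε1 => ?_
  let χR : 𝓢(Euc d, ℂ) := rescale 0 ε⁻¹ (inv_pos.2 hε) χ
  have hχR : tsupport χR ⊆ Metric.closedBall 0 (ε⁻¹ * 1) :=
    tsupport_rescale_subset _ (tsupport_cutoff_subset _ _ _)
  have hcomp : HasCompactSupport (mulSchwartz χR φ) :=
    hasCompactSupport_of_tsupport_subset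
      (((tsupport_mulSchwartz_subset _ _).trans Set.inter_subset_right).trans hχR)
  have hsub : T φ = T (φ - mulSchwartz χR φ) := by rw [map_sub, hT _ hcomp, sub_zero]
  rw [hsub, mul_assoc]
  refine hK _ _ (by positivity) fun k hk n hn x => ?_
  have hχn : ∀ i ≤ K, ‖iteratedFDeriv ℝ i χR x‖ ≤ G := by
    intro i hi
    rw [iteratedFDeriv_rescale, norm_smul, norm_pow, inv_inv, Real.norm_of_nonneg hε.le]
    have := hG 0 (Nat.zero_le _) i hi (ε • (x - 0))
    rw [pow_zero, one_mul] at this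
    calc _ ≤ 1 * G := by
          gcongr
          exact pow_le_one₀ hε.le hε1
      _ = G := one_mul _
  by_cases hx : ‖x‖ < ε⁻¹ * (1 / 2)
  · have : iteratedFDeriv ℝ n (φ - mulSchwartz χR φ : 𝓢(Euc d, ℂ)) x = 0 := by
      refine image_eq_zero_of_notMem_tsupport fun h => ?_
      refine absurd (tsupport_iteratedFDeriv_subset n h) ?_
      rw [notMem_tsupport_iff_eventuallyEq]
      filter_upwards [(isOpen_lt continuous_norm continuous_const).mem_nhds hx] with y hy
      have h1 : χR y = 1 := by
        change χ (ε⁻¹⁻¹ • (y - 0)) = 1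
        refine cutoff_eq_one _ ?_
        rw [mem_closedBall_zero_iff, sub_zero, norm_smul, inv_inv, Real.norm_of_nonneg hε.le]
        have := mul_lt_mul_of_pos_left hy hε
        rw [mul_inv_cancel_left₀ hε.ne'] at this
        exact this.le
      rw [sub_apply, mulSchwartz_apply, h1, one_mul, sub_self, Pi.zero_apply]
    rw [this, norm_zero, mul_zero]
    positivity
  -- Outside the region where the cutoff is 1, one more power of ‖x‖ buys a factor ε; hence the
  -- seminorms of φ up to K + 1.
  · have hx' : 1 ≤ 2 * ε * ‖x‖ := by
      have := mul_le_mul_of_nonneg_left (not_lt.1 hx) hε.le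
      rw [mul_inv_cancel_left₀ hε.ne'] at this
      linarith
    have hD : ‖x‖ ^ (k + 1) * ‖iteratedFDeriv ℝ n (φ - mulSchwartz χR φ : 𝓢(Euc d, ℂ)) x‖ ≤
        S + 2 ^ K * G * S := by
      have h1 : iteratedFDeriv ℝ n (φ - mulSchwartz χR φ : 𝓢(Euc d, ℂ)) x =
          iteratedFDeriv ℝ n φ x - iteratedFDeriv ℝ n (mulSchwartz χR φ) x :=
        iteratedFDeriv_sub_apply (φ.contDiffAt n) ((mulSchwartz χR φ).contDiffAt n)
      rw [h1]
      have h2 : ‖x‖ ^ (k + 1) * ‖iteratedFDeriv ℝ n (mulSchwartz χR φ) x‖ ≤ 2 ^ K * G * S := by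
        calc _ ≤ ‖x‖ ^ (k + 1) * ∑ i ∈ Finset.range (n + 1), (n.choose i : ℝ) *
              ‖iteratedFDeriv ℝ i χR x‖ * ‖iteratedFDeriv ℝ (n - i) φ x‖ := by
              gcongr
              exact norm_iteratedFDeriv_mulSchwartz_le _ _ _ _
          _ = ∑ i ∈ Finset.range (n + 1), (n.choose i : ℝ) * ‖iteratedFDeriv ℝ i χR x‖ *
              (‖x‖ ^ (k + 1) * ‖iteratedFDeriv ℝ (n - i) φ x‖) := by
              rw [Finset.mul_sum]
              exact Finset.sum_congr rfl fun i _ => by ring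
          _ ≤ ∑ i ∈ Finset.range (n + 1), (n.choose i : ℝ) * G * S := by
              gcongr with i hi
              · exact hχn i (by rw [Finset.mem_range] at hi; omega)
              · exact hS _ (by omega) _ (by omega) x
          _ = 2 ^ n * G * S := by
              rw [← Finset.sum_mul, ← Finset.sum_mul]
              congr 2
              exact_mod_cast Nat.sum_range_choose n
          _ ≤ 2 ^ K * G * S := by gcongr; norm_num
      calc _ ≤ ‖x‖ ^ (k + 1) * (‖iteratedFDeriv ℝ n φ x‖ +
            ‖iteratedFDeriv ℝ n (mulSchwartz χR φ) x‖) := by gcongr; exact norm_sub_le _ _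
        _ ≤ _ := by
          rw [mul_add]
          exact add_le_add (hS _ (by omega) _ (by omega) x) h2
    calc ‖x‖ ^ k * ‖iteratedFDeriv ℝ n (φ - mulSchwartz χR φ : 𝓢(Euc d, ℂ)) x‖
        ≤ (‖x‖ ^ k * ‖iteratedFDeriv ℝ n (φ - mulSchwartz χR φ : 𝓢(Euc d, ℂ)) x‖) *
          (2 * ε * ‖x‖) := le_mul_of_one_le_right (by positivity) hx'
      _ = 2 * ε * (‖x‖ ^ (k + 1) *
          ‖iteratedFDeriv ℝ n (φ - mulSchwartz χR φ : 𝓢(Euc d, ℂ)) x‖) := by ring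
      _ ≤ 2 * ε * (S + 2 ^ K * G * S) := by gcongr
      _ = _ := by ring

/-- A tempered distribution vanishes on test functions whose compact support is disjoint from its
support. -/
theorem apply_eq_zero_of_disjoint_supp {T : 𝓢'(Euc d, ℂ)} {φ : 𝓢(Euc d, ℂ)}
    (hc : HasCompactSupport φ) (h : Disjoint (tsupport φ) (supp T)) : T φ = 0 := by
  classical
  have h1 : ∀ x ∈ tsupport φ, ∃ r > 0, IsVanishingOn T (Metric.closedBall x r) := by
    intro x hx
    obtain ⟨s, hs, hso, hxs⟩ := (notMem_dsupport_iff x).1 (Set.disjoint_left.1 h hx)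
    obtain ⟨r, hr, hrs⟩ := Metric.nhds_basis_closedBall.mem_iff.1 (hso.mem_nhds hxs)
    exact ⟨r, hr, hs.mono hrs⟩
  choose! r hr0 hr using h1
  obtain ⟨t, ht, hcov⟩ := hc.elim_nhds_subcover (fun x => Metric.closedBall x (r x / 2))
    fun x hx => Metric.closedBall_mem_nhds x (half_pos (hr0 x hx))
  -- Balls are peeled off one at a time: ψ - χψ vanishes on the half-radius ball, where χ = 1.
  -- Stating the covering for points with ψ y ≠ 0, not for the closed support, lets it pass to the
  -- remainder.
  have key : ∀ t : Finset (Euc d), (∀ x ∈ t, x ∈ tsupport φ) → ∀ ψ : 𝓢(Euc d, ℂ),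
      (∀ y, ψ y ≠ 0 → ∃ x ∈ t, y ∈ Metric.closedBall x (r x / 2)) → T ψ = 0 := by
    intro t
    induction t using Finset.induction_on with
    | empty =>
      intro _ ψ hψ
      have : ψ = 0 := by
        ext y
        by_contra hy
        obtain ⟨x, hx, -⟩ := hψ y hy
        simp at hx
      rw [this, map_zero]
    | insert x t hxt ih =>
      intro ht ψ hψ
      have hx := ht x (by simp)
      let χ := cutoff x (r x) (hr0 x hx)
      have h2 : T (mulSchwartz χ ψ) = 0 := hr x hx _
        (((tsupport_mulSchwartz_subset _ _).trans Set.inter_subset_right).trans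
          (tsupport_cutoff_subset _ _ _))
      have h3 : T (ψ - mulSchwartz χ ψ) = 0 := by
        refine ih (fun y hy => ht y (by simp [hy])) _ fun y hy => ?_
        rw [sub_apply, mulSchwartz_apply] at hy
        have hψy : ψ y ≠ 0 := fun h0 => hy (by rw [h0, mul_zero, sub_zero])
        obtain ⟨z, hz, hyz⟩ := hψ y hψy
        rcases Finset.mem_insert.1 hz with rfl | hz
        · exact absurd (by rw [cutoff_eq_one _ hyz, one_mul, sub_self]) hy
        · exact ⟨z, hz, hyz⟩
      rwa [map_sub, h2, sub_zero] at h3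
  refine key t ht φ fun y hy => ?_
  simpa using hcov (subset_tsupport _ hy)

/-- If the jet of `R` of order `K` vanishes at `a`, then the derivatives of `R` are small near
`a`. -/
theorem norm_iteratedFDeriv_le_of_flat {R : 𝓢(Euc d, ℂ)} {a : Euc d} {K : ℕ} {C : ℝ}
    (hR : ∀ n ≤ K, iteratedFDeriv ℝ n R a = 0)
    (hC : ∀ x, ‖iteratedFDeriv ℝ (K + 1) R x‖ ≤ C) (j : ℕ) :
    ∀ n, n + j = K + 1 → ∀ x, ‖iteratedFDeriv ℝ n R x‖ ≤ C * ‖x - a‖ ^ j := by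
  induction j with
  | zero =>
    intro n hn x
    obtain rfl : n = K + 1 := by omega
    simpa using hC x
  | succ j ih =>
    intro n hn x
    have hdiff : Differentiable ℝ (iteratedFDeriv ℝ n R) :=
      (R.smooth (n + 1 : ℕ)).differentiable_iteratedFDeriv (by exact_mod_cast Nat.lt_succ_self n)
    have hC0 : 0 ≤ C := (norm_nonneg _).trans (hC x)
    have := (convex_closedBall a ‖x - a‖).norm_image_sub_le_of_norm_fderiv_le (𝕜 := ℝ)
      (f := iteratedFDeriv ℝ n R) (C := C * ‖x - a‖ ^ j) (x := a) (y := x)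
      (fun y _ => hdiff y) (fun y hy => by
        rw [norm_fderiv_iteratedFDeriv]
        refine (ih (n + 1) (by omega) y).trans ?_
        gcongr
        exact mem_closedBall_iff_norm.1 hy)
      (Metric.mem_closedBall_self (norm_nonneg _)) (mem_closedBall_iff_norm.2 le_rfl)
    rw [hR n (by omega), sub_zero] at this
    rwa [pow_succ, ← mul_assoc]

/-- Near an isolated point of its support, a distribution only depends on a finite jet. -/
theorem exists_jet_order (T : 𝓢'(Euc d, ℂ)) : ∃ K : ℕ, ∀ (a : Euc d) (r : ℝ) (hr : 0 < r),
    supp T ∩ Metric.closedBall a r ⊆ {a} → ∀ φ : 𝓢(Euc d, ℂ),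
      (∀ k : Fin d → ℕ, len k ≤ K → dualDeriv k φ a = 0) →
      T (mulSchwartz (cutoff a r hr) φ) = 0 := by
  obtain ⟨K, C, hC, hK⟩ := exists_seminorm_bound T
  refine ⟨K, fun a r hr hiso φ hφ => ?_⟩
  set R := mulSchwartz (cutoff a r hr) φ with hRdef
  have hRsupp : tsupport R ⊆ Metric.closedBall a r :=
    ((tsupport_mulSchwartz_subset _ _).trans Set.inter_subset_right).trans
      (tsupport_cutoff_subset _ _ _)
  have hR : ∀ n ≤ K, iteratedFDeriv ℝ n R a = 0 := fun n hn =>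
    iteratedFDeriv_eq_zero_of_dualDeriv (M := K) (fun k hk => by
      rw [← hφ k hk]
      refine dualDeriv_congr ?_
      filter_upwards [cutoff_eventuallyEq_one a r hr] with x hx
      rw [hRdef, mulSchwartz_apply, hx, Pi.one_apply, one_mul]) hn
  set D := SchwartzMap.seminorm ℂ 0 (K + 1) R
  have hD0 : 0 ≤ D := apply_nonneg _ _
  have hflat := norm_iteratedFDeriv_le_of_flat hR
    fun x => SchwartzMap.norm_iteratedFDeriv_le_seminorm ℂ R (K + 1) x
  let χ : 𝓢(Euc d, ℂ) := cutoff 0 1 one_pos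
  obtain ⟨G, hG0, hG⟩ := exists_uniform_seminorm_bound χ K
  refine eq_zero_of_norm_le_mul (C := C * ((1 + ‖a‖) ^ K * (2 ^ K * G * D))) one_pos
    fun ε hε hε1 => ?_
  let ψ : 𝓢(Euc d, ℂ) := rescale a ε hε χ
  have hψsupp : tsupport ψ ⊆ Metric.closedBall a (ε * 1) :=
    tsupport_rescale_subset hε (tsupport_cutoff_subset _ _ _)
  have hsub : T R = T (mulSchwartz ψ R) := by
    rw [← sub_eq_zero, ← map_sub]
    have hts : tsupport (R - mulSchwartz ψ R : 𝓢(Euc d, ℂ)) ⊆ tsupport R :=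
      closure_mono fun x hx h0 => hx (by
        rw [sub_apply, mulSchwartz_apply ψ, h0, mul_zero, sub_zero])
    refine apply_eq_zero_of_disjoint_supp (hasCompactSupport_of_tsupport_subset (hts.trans hRsupp))
      (Set.disjoint_left.2 fun x hx hxT => ?_)
    obtain rfl : x = a := hiso ⟨hxT, hRsupp (hts hx)⟩
    refine absurd hx ?_
    rw [notMem_tsupport_iff_eventuallyEq]
    filter_upwards [Metric.closedBall_mem_nhds x (half_pos hε)] with y hy
    have h1 : ψ y = 1 := by
      change χ (ε⁻¹ • (y - x)) = 1
      refine cutoff_eq_one _ ?_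
      rw [mem_closedBall_zero_iff, norm_smul, norm_inv, Real.norm_of_nonneg hε.le,
        inv_mul_le_iff₀ hε]
      have := mem_closedBall_iff_norm.1 hy
      linarith
    rw [sub_apply, mulSchwartz_apply ψ, h1, one_mul, sub_self, Pi.zero_apply]
  rw [hsub, mul_assoc]
  refine hK _ _ (by positivity) fun k hk n hn x => ?_
  by_cases hx : x ∈ tsupport ψ
  · have hxa : ‖x - a‖ ≤ ε := by simpa using mem_closedBall_iff_norm.1 (hψsupp hx)
    have hxn : ‖x‖ ≤ 1 + ‖a‖ := by
      have h2 : ‖x‖ ≤ ‖x - a‖ + ‖a‖ := by simpa using norm_add_le (x - a) a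
      linarith
    -- In the Leibniz formula i derivatives of ψ cost ε^(-i), while flatness of R gains
    -- ε^(K+1-(n-i)) ≤ ε^(i+1) because n ≤ K. One factor ε survives.
    have h1 : ‖iteratedFDeriv ℝ n (mulSchwartz ψ R) x‖ ≤ 2 ^ K * G * D * ε := by
      calc _ ≤ _ := norm_iteratedFDeriv_mulSchwartz_le _ _ _ _
        _ ≤ ∑ i ∈ Finset.range (n + 1), (n.choose i : ℝ) * G * (D * ε) := by
            refine Finset.sum_le_sum fun i hi => ?_
            rw [Finset.mem_range] at hi
            rw [mul_assoc, mul_assoc]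
            refine mul_le_mul_of_nonneg_left ?_ (Nat.cast_nonneg _)
            have h2 := hG 0 (Nat.zero_le _) i (by omega) (ε⁻¹ • (x - a))
            rw [pow_zero, one_mul] at h2
            have h3 := hflat (K + 1 - (n - i)) (n - i) (by omega) x
            rw [iteratedFDeriv_rescale, norm_smul, norm_pow, norm_inv, Real.norm_of_nonneg hε.le]
            calc _ ≤ ε⁻¹ ^ i * G * (D * ε ^ (K + 1 - (n - i))) := by
                  gcongr
                  exact h3.trans (by gcongr)
              _ ≤ ε⁻¹ ^ i * G * (D * ε ^ (i + 1)) := by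
                  gcongr ε⁻¹ ^ i * G * (D * ?_)
                  exact pow_le_pow_of_le_one hε.le hε1 (by omega)
              _ = (ε⁻¹ * ε) ^ i * (G * (D * ε)) := by rw [mul_pow, pow_succ]; ring
              _ = G * (D * ε) := by rw [inv_mul_cancel₀ hε.ne', one_pow, one_mul]
        _ = 2 ^ n * G * (D * ε) := by
            rw [← Finset.sum_mul, ← Finset.sum_mul]
            congr 2
            exact_mod_cast Nat.sum_range_choose n
        _ ≤ 2 ^ K * G * (D * ε) := by gcongr; norm_num
        _ = _ := by ring
    calc _ ≤ (1 + ‖a‖) ^ k * (2 ^ K * G * D * ε) := by gcongr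
      _ ≤ (1 + ‖a‖) ^ K * (2 ^ K * G * D * ε) := by
        gcongr
        linarith [norm_nonneg a]
      _ = _ := by ring
  · have : iteratedFDeriv ℝ n (mulSchwartz ψ R) x = 0 :=
      image_eq_zero_of_notMem_tsupport fun h =>
        hx ((tsupport_mulSchwartz_subset _ _ (tsupport_iteratedFDeriv_subset n h)).2)
    rw [this, norm_zero, mul_zero]
    positivity

/-- A tempered distribution with locally finite support is a sum of derivatives of point masses. -/
theorem exists_isDeltaDerivSum {T : 𝓢'(Euc d, ℂ)} (hT : IsLocallyFinite (supp T)) :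
    ∃ p : Euc d → ((Fin d → ℕ) →₀ ℂ), IsDeltaDerivSum T (supp T) p := by
  classical
  obtain ⟨K, hK⟩ := exists_jet_order T
  have hiso : ∀ a, ∃ r > 0, supp T ∩ Metric.closedBall a r ⊆ {a} := fun a => by
    obtain ⟨r, hr0, hr⟩ := hT.exists_isolating a
    exact ⟨r / 2, half_pos hr0, (Set.inter_subset_inter_right _
      (Metric.closedBall_subset_ball (half_lt_self hr0))).trans hr⟩
  choose r hr0 hr using hiso
  let cut : Euc d → 𝓢(Euc d, ℂ) := fun a => cutoff a (r a) (hr0 a)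
  have hloc : ∀ a, ∃ c : multiIndices d K → ℂ, ∀ φ : 𝓢(Euc d, ℂ),
      T (mulSchwartz (cut a) φ) = ∑ k, c k * dualDeriv k.1 φ a := by
    intro a
    let L : multiIndices d K → (𝓢(Euc d, ℂ) →ₗ[ℂ] ℂ) := fun k =>
      (TemperedDistribution.delta a).toLinearMap ∘ₗ (dualDeriv k.1).toLinearMap
    let F : 𝓢(Euc d, ℂ) →ₗ[ℂ] ℂ := T.toLinearMap ∘ₗ (mulSchwartz (cut a)).toLinearMap
    -- A linear form vanishing on the common kernel of finitely many forms is a combination of them.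
    have hmem : F ∈ Submodule.span ℂ (Set.range L) := by
      refine mem_span_of_iInf_ker_le_ker fun φ hφ => ?_
      rw [Submodule.mem_iInf] at hφ
      exact hK a (r a) (hr0 a) (hr a) φ fun k hk => hφ ⟨k, mem_multiIndices.2 hk⟩
    obtain ⟨c, hc⟩ := (Submodule.mem_span_range_iff_exists_fun ℂ).1 hmem
    refine ⟨c, fun φ => ?_⟩
    have := LinearMap.congr_fun hc φ
    rw [LinearMap.sum_apply] at this
    exact this.symm
  choose c hc using hloc
  refine ⟨fun a => ∑ k, Finsupp.single k.1 (c a k), fun φ hφ => ?_⟩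
  have hterm : ∀ a, ((∑ k, Finsupp.single k.1 (c a k) : (Fin d → ℕ) →₀ ℂ).sum fun k z =>
      z * multiDeriv k (TemperedDistribution.delta a) φ) = T (mulSchwartz (cut a) φ) := by
    intro a
    rw [hc, ← Finsupp.sum_finsetSum_index (by simp) (by intros; ring)]
    refine Finset.sum_congr rfl fun k _ => ?_
    rw [Finsupp.sum_single_index (by simp), multiDeriv_apply, TemperedDistribution.delta_apply]
  simp only [hterm]
  have hfin : (supp T ∩ tsupport φ).Finite := by
    obtain ⟨ρ, hρ⟩ := hφ.isBounded.subset_ball 0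
    exact (hT 0 ρ).subset (Set.inter_subset_inter_right _ hρ)
  have hcut0 : ∀ a b, b ∈ supp T → b ≠ a → b ∉ tsupport (cut a) := fun a b hb hne h =>
    hne (hr a ⟨hb, tsupport_cutoff_subset _ _ _ h⟩)
  have hzero : ∀ a, a ∉ tsupport φ → T (mulSchwartz (cut a) φ) = 0 := by
    intro a ha
    rw [hc]
    exact Finset.sum_eq_zero fun k _ => by rw [dualDeriv_apply_eq_zero ha, mul_zero]
  -- Near each support point b exactly one cutoff is 1 and the others are 0, so the difference is
  -- supported away from `supp T`.
  have hsum : T φ = ∑ a ∈ hfin.toFinset, T (mulSchwartz (cut a) φ) := by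
    rw [← map_sum, ← sub_eq_zero, ← map_sub]
    have hts : tsupport (φ - ∑ a ∈ hfin.toFinset, mulSchwartz (cut a) φ : 𝓢(Euc d, ℂ)) ⊆
        tsupport φ := closure_mono fun x hx h0 => hx (by
      rw [sub_apply, sum_apply, h0, Finset.sum_eq_zero, sub_zero]
      intro a _
      rw [mulSchwartz_apply, h0, mul_zero])
    refine apply_eq_zero_of_disjoint_supp (hφ.of_isClosed_subset (isClosed_tsupport _) hts)
      (Set.disjoint_left.2 fun b hb hbT => ?_)
    have hbm : b ∈ hfin.toFinset := by simpa using ⟨hbT, hts hb⟩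
    refine absurd hb ?_
    rw [notMem_tsupport_iff_eventuallyEq]
    have h2 : ∀ᶠ y in nhds b, ∀ a ∈ hfin.toFinset.erase b, cut a y = 0 := by
      rw [Filter.eventually_all_finset]
      intro a ha
      exact notMem_tsupport_iff_eventuallyEq.1 (hcut0 a b hbT (Finset.ne_of_mem_erase ha).symm)
    filter_upwards [h2, cutoff_eventuallyEq_one b (r b) (hr0 b)] with y hy1 hy2
    rw [sub_apply, sum_apply, ← Finset.add_sum_erase _ _ hbm, Finset.sum_eq_zero, add_zero,
      mulSchwartz_apply, show cut b y = 1 from hy2, one_mul, sub_self, Pi.zero_apply]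
    intro a ha
    rw [mulSchwartz_apply, hy1 a ha, zero_mul]
  rw [hsum]
  have hs : ∑ a ∈ hfin.toFinset, T (mulSchwartz (cut a) φ) =
      ∑ a ∈ hfin.toFinset.subtype (· ∈ supp T), T (mulSchwartz (cut a) φ) :=
    (Finset.sum_subtype_of_mem (fun a => T (mulSchwartz (cut a) φ))
      fun a ha => ((Set.Finite.mem_toFinset hfin).1 ha).1).symm
  rw [hs]
  exact hasSum_sum_of_ne_finset_zero fun a ha => hzero a fun h => ha (by simp [h])

/-! ### Decomposition into derivatives of the μ_k -/

/-- A distribution of finite order with discrete support is the sum of the derivatives of the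
distributions formed by its coefficients. -/
theorem IsDeltaDerivSum.eq_sum {f : 𝓢'(Euc d, ℂ)} {A : Set (Euc d)}
    {p : Euc d → ((Fin d → ℕ) →₀ ℂ)} (hf : IsDeltaDerivSum f A p) {K : ℕ}
    (hK : ∀ a ∈ A, ∀ m, K < len m → p a m = 0) {μ : (Fin d → ℕ) → 𝓢'(Euc d, ℂ)}
    (hμ : ∀ k φ, HasSum (fun a : A => p a k * φ a) (μ k φ)) (φ : 𝓢(Euc d, ℂ)) :
    f φ = ∑ k ∈ multiIndices d K, μ k (dualDeriv k φ) := by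
  have key : ∀ φ : 𝓢(Euc d, ℂ), (f - ∑ k ∈ multiIndices d K, multiDeriv k (μ k)) φ =
      f φ - ∑ k ∈ multiIndices d K, μ k (dualDeriv k φ) := by
    intro φ
    rw [sub_apply, sum_apply]
    simp only [multiDeriv_apply]
  rw [← sub_eq_zero, ← key]
  refine eq_zero_of_forall_hasCompactSupport (fun φ hφ => ?_) φ
  rw [key, sub_eq_zero]
  refine (hf φ hφ).unique ?_
  have h1 := hasSum_sum fun k (_ : k ∈ multiIndices d K) => hμ k (dualDeriv k φ)
  convert h1 using 2 with a
  rw [Finsupp.sum_of_support_subset (s := multiIndices d K)]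
  · simp only [multiDeriv_apply, TemperedDistribution.delta_apply]
  · intro k hk
    rw [mem_multiIndices]
    by_contra h
    exact Finsupp.mem_support_iff.1 hk (hK a a.2 k (not_le.1 h))
  · simp

/-! ### Translations and recurrence -/

/-- Translation of Schwartz functions. -/
abbrev translate (t : Euc d) : 𝓢(Euc d, ℂ) →L[ℂ] 𝓢(Euc d, ℂ) := rescale t 1 one_pos

theorem translate_apply (t : Euc d) (φ : 𝓢(Euc d, ℂ)) (x : Euc d) :
    translate t φ x = φ (x - t) := by
  rw [rescale_apply, inv_one, one_smul]

theorem tsupport_translate_subset {t a : Euc d} {r : ℝ} {φ : 𝓢(Euc d, ℂ)}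
    (h : tsupport φ ⊆ Metric.closedBall a r) :
    tsupport (translate t φ) ⊆ Metric.closedBall (a + t) r := by
  refine closure_minimal (fun x hx => ?_) Metric.isClosed_closedBall
  rw [Function.mem_support, translate_apply] at hx
  have := mem_closedBall_iff_norm.1 (h (subset_tsupport _ hx))
  rw [mem_closedBall_iff_norm]
  rwa [sub_sub, add_comm] at this

/-- The exponents occurring in the expansion of `(y + t)^k`. -/
def lowerBox (k : Fin d → ℕ) : Finset (Fin d → ℕ) :=
  Fintype.piFinset fun j => Finset.range (k j + 1)

/-- The coefficient of the monomial of exponent `l` in `∏ⱼ (2πi (yⱼ + tⱼ))^{kⱼ}`. -/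
def shiftCoeff (k l : Fin d → ℕ) (t : Fin d → ℂ) : ℂ :=
  ∏ j, ((2 * Real.pi * Complex.I * t j) ^ (k j - l j) * ((k j).choose (l j) : ℂ))

/-- Expanding y = (y - t) + t splits the dependence on t into polynomial coefficients, which grow,
and translations, which recur. -/
theorem mulMonomial_translate (k : Fin d → ℕ) (t : Euc d) (φ : 𝓢(Euc d, ℂ)) :
    mulMonomial k (translate t φ) =
      ∑ l ∈ lowerBox k, shiftCoeff k l (fun j => (t j : ℂ)) • translate t (mulMonomial l φ) := by
  ext y
  rw [mulMonomial_apply, sum_apply, translate_apply]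
  have h1 : ∀ j, (2 * Real.pi * Complex.I * (y j : ℂ)) ^ k j = ∑ l ∈ Finset.range (k j + 1),
      (2 * Real.pi * Complex.I * ((y - t) j : ℂ)) ^ l *
      (2 * Real.pi * Complex.I * (t j : ℂ)) ^ (k j - l) * ((k j).choose l : ℂ) := by
    intro j
    rw [← add_pow, ← mul_add]
    simp
  rw [Finset.prod_congr rfl fun j _ => h1 j, Finset.prod_univ_sum, Finset.sum_mul]
  refine Finset.sum_congr rfl fun l _ => ?_
  rw [smul_apply, translate_apply, mulMonomial_apply, smul_eq_mul, shiftCoeff, ← mul_assoc,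
    ← Finset.prod_mul_distrib]
  congr 1
  exact Finset.prod_congr rfl fun j _ => by ring

theorem shiftCoeff_smul (k l : Fin d → ℕ) (s : ℂ) (t : Fin d → ℂ) :
    shiftCoeff k l (fun j => s * t j) = s ^ len (k - l) * shiftCoeff k l t := by
  rw [shiftCoeff, shiftCoeff, len, ← Finset.prod_pow_eq_pow_sum, ← Finset.prod_mul_distrib]
  refine Finset.prod_congr rfl fun j _ => ?_
  rw [Pi.sub_apply, mul_left_comm _ s, mul_pow, mul_assoc]

open Polynomial in
/-- If the coefficients of a family of polynomials of bounded degree are recurrent and each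
polynomial vanishes at its own parameter, then all the polynomials vanish. -/
theorem polynomial_eq_zero_of_recurrent {𝓤 : Filter ℕ} [𝓤.NeBot] (h𝓤 : 𝓤 ≤ Filter.atTop)
    {R : ℝ → ℂ[X]} (D : ℕ) (hD : ∀ s, ∀ m ≥ D, (R s).coeff m = 0)
    (hrec : ∀ s m, Filter.Tendsto (fun n : ℕ => (R (s + n)).coeff m) 𝓤 (nhds ((R s).coeff m)))
    (hev : ∀ s, (R s).eval (s : ℂ) = 0) (s : ℝ) : R s = 0 := by
  induction D with
  | zero => exact Polynomial.ext fun m => by simpa using hD s m (Nat.zero_le _)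
  | succ D ih =>
    refine ih fun s m hm => ?_
    rcases hm.lt_or_eq with hm | rfl
    · exact hD s m hm
    have hz : Filter.Tendsto (fun n : ℕ => (s + n : ℝ)) 𝓤 Filter.atTop :=
      (Filter.tendsto_atTop_add_const_left _ s tendsto_natCast_atTop_atTop).mono_left h𝓤
    have hinv : Filter.Tendsto (fun n : ℕ => (((s + n : ℝ) : ℂ))⁻¹) 𝓤 (nhds 0) := by
      rw [tendsto_zero_iff_norm_tendsto_zero]
      have h1 := hz.inv_tendsto_atTop.norm
      rw [norm_zero] at h1
      refine h1.congr fun n => ?_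
      rw [norm_inv, Complex.norm_real, Pi.inv_apply, norm_inv]
    -- This is the equation R(s+n)(s+n) = 0 divided by (s+n)^D. In the limit 0^(D-m) keeps only m =
    -- D, and recurrence turns the top coefficient into that of `R s`.
    have hlim : Filter.Tendsto (fun n : ℕ => ∑ m ∈ Finset.range (D + 1),
        (R (s + n)).coeff m * (((s + n : ℝ) : ℂ))⁻¹ ^ (D - m)) 𝓤
        (nhds (∑ m ∈ Finset.range (D + 1), (R s).coeff m * 0 ^ (D - m))) :=
      tendsto_finsetSum _ fun m _ => (hrec s m).mul (hinv.pow _)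
    have hval : ∑ m ∈ Finset.range (D + 1), (R s).coeff m * 0 ^ (D - m) = (R s).coeff D := by
      rw [Finset.sum_eq_single D]
      · simp
      · intro m hm hne
        rw [Finset.mem_range] at hm
        rw [zero_pow (by omega), mul_zero]
      · simp
    rw [hval] at hlim
    refine tendsto_nhds_unique hlim (tendsto_const_nhds.congr' ?_)
    filter_upwards [hz.eventually_gt_atTop 0] with n hn
    have hne : ((s + n : ℝ) : ℂ) ≠ 0 := Complex.ofReal_ne_zero.2 hn.ne'
    have hdeg : (R (s + n)).natDegree < D + 1 := by
      refine Nat.lt_succ_of_le (natDegree_le_iff_coeff_eq_zero.2 fun m hm => hD _ m hm)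
    have h0 := hev (s + n)
    rw [eval_eq_sum_range' hdeg] at h0
    have h1 := congrArg (fun z => z * ((((s + n : ℝ) : ℂ))⁻¹) ^ D) h0
    simp only [zero_mul, Finset.sum_mul] at h1
    rw [← h1]
    refine Finset.sum_congr rfl fun m hm => ?_
    rw [Finset.mem_range] at hm
    obtain ⟨e, rfl⟩ : ∃ e, D = m + e := ⟨D - m, by omega⟩
    rw [Nat.add_sub_cancel_left, pow_add, mul_assoc, ← mul_assoc (((s + n : ℝ) : ℂ) ^ m),
      ← mul_pow, mul_inv_cancel₀ hne, one_pow, one_mul]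

/-- Simultaneous recurrence of characters. -/
theorem exists_recurrence_filter {ι : Type*} (θ : ι → ℝ) : ∃ 𝓤 : Filter ℕ, 𝓤.NeBot ∧
    𝓤 ≤ Filter.atTop ∧ ∀ i, Filter.Tendsto
      (fun n : ℕ => (Real.fourierChar ((n : ℝ) * θ i) : ℂ)) 𝓤 (nhds 1) := by
  -- In the compact group of functions ι → Circle the identity is a cluster point of the powers of
  -- any element; an ultrafilter handles all indices at once.
  have h := mapClusterPt_one_atTop_pow (fun i => Real.fourierChar (θ i) : ι → Circle)
  obtain ⟨U, hU, hlim⟩ := mapClusterPt_iff_ultrafilter.1 h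
  refine ⟨U, inferInstance, hU, fun i => ?_⟩
  have h1 := (tendsto_pi_nhds.1 hlim) i
  have hc : Continuous fun z : Circle => (z : ℂ) := by fun_prop
  have h2 : Filter.Tendsto (fun n : ℕ => ((Real.fourierChar (θ i) ^ n : Circle) : ℂ)) U
      (nhds 1) := by
    have h2 := (hc.tendsto 1).comp h1
    rwa [Circle.coe_one] at h2
  refine h2.congr fun n => ?_
  rw [← AddChar.map_nsmul_eq_pow, nsmul_eq_mul]

/-- The Fourier transform of a sum of point masses is recurrent along every direction. -/
theorem tendsto_fourier_translate {A : Set (Euc d)} {c : Euc d → ℂ} {μ : 𝓢'(Euc d, ℂ)}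
    (hμ : ∀ φ : 𝓢(Euc d, ℂ), Summable (fun a : A => ‖c a * φ a‖) ∧
      HasSum (fun a : A => c a * φ a) (μ φ)) {ω : Euc d} {𝓤 : Filter ℕ}
    (h𝓤 : ∀ a : A, Filter.Tendsto
      (fun n : ℕ => (Real.fourierChar ((n : ℝ) * (-inner ℝ ω (a : Euc d))) : ℂ)) 𝓤 (nhds 1))
    (φ : 𝓢(Euc d, ℂ)) (s : ℝ) :
    Filter.Tendsto (fun n : ℕ => 𝓕 μ (translate ((s + n) • ω) φ)) 𝓤
      (nhds (𝓕 μ (translate (s • ω) φ))) := by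
  have hval : ∀ t : Euc d, 𝓕 μ (translate t φ) =
      ∑' a : A, c a * ((Real.fourierChar (-inner ℝ t (a : Euc d)) : ℂ) * 𝓕 φ (a : Euc d)) := by
    intro t
    rw [TemperedDistribution.fourier_apply, ← (hμ _).2.tsum_eq]
    refine tsum_congr fun a => ?_
    rw [fourier_rescale]
    simp
  simp only [hval]
  -- The characters have modulus 1, so the untranslated series dominates.
  refine tendsto_tsum_of_dominated_convergence (hμ (𝓕 φ)).1 (fun a => ?_) (.of_forall fun n a => ?_)
  · have h1 : ∀ n : ℕ, (Real.fourierChar (-inner ℝ ((s + n) • ω) (a : Euc d)) : ℂ) =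
        (Real.fourierChar (-inner ℝ (s • ω) (a : Euc d)) : ℂ) *
          (Real.fourierChar ((n : ℝ) * (-inner ℝ ω (a : Euc d))) : ℂ) := by
      intro n
      rw [add_smul, inner_add_left, neg_add, AddChar.map_add_eq_mul, Circle.coe_mul,
        inner_smul_left ω _ (n : ℝ), mul_neg]
      rfl
    simp only [h1]
    have := ((h𝓤 a).const_mul (Real.fourierChar (-inner ℝ (s • ω) (a : Euc d)) : ℂ)).mul_const
      (𝓕 φ (a : Euc d))
    rw [mul_one] at this
    exact this.const_mul _
  · rw [norm_mul, norm_mul, norm_mul, Circle.norm_coe, one_mul]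

/-! ### Separation of the spectra -/

section Separation

variable {S : Finset (Fin d → ℕ)} {F : 𝓢'(Euc d, ℂ)} {ν : (Fin d → ℕ) → 𝓢'(Euc d, ℂ)}

/-- The polynomial whose value at `t` is `∑ₖ νₖ ((2πi (y + t))^k φ)`. -/
def shiftPolynomial (S : Finset (Fin d → ℕ)) (ν : (Fin d → ℕ) → 𝓢'(Euc d, ℂ))
    (φ : 𝓢(Euc d, ℂ)) : MvPolynomial (Fin d) ℂ :=
  ∑ k ∈ S, ∑ l ∈ lowerBox k, MvPolynomial.monomial (Finsupp.equivFunOnFinite.symm (k - l))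
    (shiftCoeff k l 1 * ν k (mulMonomial l φ))

theorem eval_shiftPolynomial (φ : 𝓢(Euc d, ℂ)) (x : Fin d → ℂ) :
    (shiftPolynomial S ν φ).eval x =
      ∑ k ∈ S, ∑ l ∈ lowerBox k, shiftCoeff k l x * ν k (mulMonomial l φ) := by
  simp only [shiftPolynomial, map_sum, MvPolynomial.eval_monomial]
  refine Finset.sum_congr rfl fun k _ => Finset.sum_congr rfl fun l _ => ?_
  rw [Finsupp.prod_fintype _ _ (by simp), mul_right_comm]
  congr 1
  rw [shiftCoeff, shiftCoeff, ← Finset.prod_mul_distrib]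
  refine Finset.prod_congr rfl fun j _ => ?_
  simp only [Pi.one_apply, mul_one, Finsupp.equivFunOnFinite_symm_apply_apply, Pi.sub_apply]
  rw [mul_pow]
  ring

open Polynomial in
/-- If `F = ∑ₖ (2πi y)^k νₖ` with `νₖ` recurrent, and of any two simultaneous translates of `φ₁`
and `φ₂` at least one is annihilated by `F`, then one of the shift polynomials vanishes. -/
theorem shiftPolynomial_eq_zero_or
    (hF : ∀ φ, F φ = ∑ k ∈ S, ν k (mulMonomial k φ))
    (hrec : ∀ ω : Euc d, ∃ 𝓤 : Filter ℕ, 𝓤.NeBot ∧ 𝓤 ≤ Filter.atTop ∧ ∀ k ∈ S, ∀ φ, ∀ s : ℝ,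
      Filter.Tendsto (fun n : ℕ => ν k (translate ((s + n) • ω) φ)) 𝓤
        (nhds (ν k (translate (s • ω) φ))))
    {φ₁ φ₂ : 𝓢(Euc d, ℂ)} (h : ∀ t, F (translate t φ₁) = 0 ∨ F (translate t φ₂) = 0) :
    shiftPolynomial S ν φ₁ = 0 ∨ shiftPolynomial S ν φ₂ = 0 := by
  rw [← mul_eq_zero]
  refine MvPolynomial.eq_zero_of_eval_real fun x => ?_
  let ω : Euc d := WithLp.toLp 2 x
  obtain ⟨𝓤, hne, h𝓤, hrec⟩ := hrec ω
  -- Two roles of the translation parameter are separated: in `Q φ s` the translation of the ν_k is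
  -- frozen at sω, and the monomial growth is kept as a formal variable. Setting the variable to s
  -- recovers F.
  let Q : 𝓢(Euc d, ℂ) → ℝ → ℂ[X] := fun φ s => ∑ k ∈ S, ∑ l ∈ lowerBox k,
    Polynomial.monomial (len (k - l)) (shiftCoeff k l (fun j => (x j : ℂ)) *
      ν k (translate (s • ω) (mulMonomial l φ)))
  have hQeval : ∀ φ s, (Q φ s).eval (s : ℂ) = F (translate (s • ω) φ) := by
    intro φ s
    rw [hF]
    simp only [Q, eval_finsetSum, eval_monomial, mulMonomial_translate, map_sum, map_smul]
    refine Finset.sum_congr rfl fun k _ => Finset.sum_congr rfl fun l _ => ?_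
    have : (fun j => (((s • ω : Euc d) j : ℝ) : ℂ)) = fun j => (s : ℂ) * (x j : ℂ) := by
      ext j
      simp [ω]
    rw [this, shiftCoeff_smul, smul_eq_mul]
    ring
  have hQcoeff : ∀ φ s m, (Q φ s).coeff m = ∑ k ∈ S, ∑ l ∈ lowerBox k,
      if len (k - l) = m then shiftCoeff k l (fun j => (x j : ℂ)) *
        ν k (translate (s • ω) (mulMonomial l φ)) else 0 := by
    intro φ s m
    simp only [Q, finsetSum_coeff, coeff_monomial]
  have hQrec : ∀ φ s m, Filter.Tendsto (fun n : ℕ => (Q φ (s + n)).coeff m) 𝓤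
      (nhds ((Q φ s).coeff m)) := by
    intro φ s m
    simp only [hQcoeff]
    refine tendsto_finsetSum _ fun k hk => tendsto_finsetSum _ fun l _ => ?_
    split_ifs
    · exact (hrec k hk _ s).const_mul _
    · exact tendsto_const_nhds
  let D := S.sup len
  have hQdeg : ∀ φ s, (Q φ s).natDegree ≤ D := by
    intro φ s
    refine natDegree_sum_le_of_forall_le _ _ fun k hk =>
      natDegree_sum_le_of_forall_le _ _ fun l _ => (natDegree_monomial_le _).trans ?_
    exact (Finset.sum_le_sum fun j _ => Nat.sub_le _ _).trans (Finset.le_sup (f := len) hk)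
  have hzero := polynomial_eq_zero_of_recurrent h𝓤 (R := fun s => Q φ₁ s * Q φ₂ s) (D + D + 1)
    (fun s m hm => coeff_eq_zero_of_natDegree_lt
      ((natDegree_mul_le.trans (add_le_add (hQdeg _ _) (hQdeg _ _))).trans_lt hm))
    (fun s m => by
      simp only [coeff_mul]
      exact tendsto_finsetSum _ fun i _ => (hQrec _ _ _).mul (hQrec _ _ _))
    (fun s => by
      rw [eval_mul, hQeval, hQeval]
      exact mul_eq_zero.2 (h _)) 0
  -- At s = 0 nothing is translated, and the variable 1 gives the shift polynomial at the real point
  -- x.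
  have hQ1 : ∀ φ, (Q φ 0).eval 1 = (shiftPolynomial S ν φ).eval fun j => (x j : ℂ) := by
    intro φ
    rw [eval_shiftPolynomial]
    simp only [Q, eval_finsetSum, eval_monomial, one_pow, mul_one, zero_smul]
    refine Finset.sum_congr rfl fun k _ => Finset.sum_congr rfl fun l _ => ?_
    congr 2
    ext y
    rw [translate_apply, sub_zero]
  have := congrArg (Polynomial.eval 1) hzero
  rwa [eval_mul, hQ1, hQ1, eval_zero, ← map_mul] at this

/-- The coefficient of t^k is a nonzero multiple of ν_k φ plus values of ν_k' with k' longer than k.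
Induction from the longest indices downwards removes the latter; stability of `W` under monomials is
needed there. -/
theorem eq_zero_of_shiftPolynomial_eq_zero {W : Set 𝓢(Euc d, ℂ)}
    (hW : ∀ φ ∈ W, ∀ l, mulMonomial l φ ∈ W) (h : ∀ φ ∈ W, shiftPolynomial S ν φ = 0) :
    ∀ k ∈ S, ∀ φ ∈ W, ν k φ = 0 := by
  have key : ∀ e, ∀ k ∈ S, S.sup len - len k = e → ∀ φ ∈ W, ν k φ = 0 := by
    intro e
    induction e using Nat.strong_induction_on with
    | _ e ih =>
    intro k hk hke φ hφ
    have hc := congrArg (MvPolynomial.coeff (Finsupp.equivFunOnFinite.symm k)) (h φ hφ)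
    simp only [shiftPolynomial, MvPolynomial.coeff_sum, MvPolynomial.coeff_monomial,
      EmbeddingLike.apply_eq_iff_eq, MvPolynomial.coeff_zero] at hc
    have hterm : ∀ k' ∈ S, ∀ l ∈ lowerBox k', k' ≠ k ∨ l ≠ 0 →
        (if k' - l = k then shiftCoeff k' l 1 * ν k' (mulMonomial l φ) else 0) = 0 := by
      intro k' hk' l hl hne
      split_ifs with heq
      · have hle : ∀ j, l j ≤ k' j := fun j => by
          have := Fintype.mem_piFinset.1 hl j
          rw [Finset.mem_range] at this
          omega
        have hlen : len k' = len k + len l := by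
          simp only [len, ← Finset.sum_add_distrib, ← heq, Pi.sub_apply]
          exact Finset.sum_congr rfl fun j _ => (Nat.sub_add_cancel (hle j)).symm
        have hl0 : l ≠ 0 := by
          rintro rfl
          rw [tsub_zero] at heq
          exact hne.elim (fun h => h heq) fun h => h rfl
        have hl1 : len l ≠ 0 := fun h0 => hl0 (funext fun j =>
          (Finset.sum_eq_zero_iff.1 h0) j (Finset.mem_univ j))
        have hsup : len k' ≤ S.sup len := Finset.le_sup (f := len) hk'
        rw [ih (S.sup len - len k') (by omega) k' hk' rfl _ (hW φ hφ l), mul_zero]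
      · rfl
    have h0 : (0 : Fin d → ℕ) ∈ lowerBox k := Fintype.mem_piFinset.2 fun j => by simp
    rw [Finset.sum_eq_single_of_mem k hk fun k' hk' hne => Finset.sum_eq_zero fun l hl =>
        hterm k' hk' l hl (Or.inl hne),
      Finset.sum_eq_single_of_mem 0 h0 fun l hl hne => hterm k hk l hl (Or.inr hne),
      if_pos (tsub_zero k)] at hc
    have hcoeff : shiftCoeff k 0 1 ≠ 0 := Finset.prod_ne_zero_iff.2 fun j _ => by
      simp [Real.pi_ne_zero]
    have hmul : mulMonomial 0 φ = φ := by
      ext y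
      simp [mulMonomial_apply]
    rw [hmul] at hc
    exact (mul_eq_zero.1 hc).resolve_left hcoeff
  exact fun k hk => key _ k hk rfl

theorem mem_supp_of_apply_ne_zero {T : 𝓢'(Euc d, ℂ)} {φ : 𝓢(Euc d, ℂ)} {a : Euc d} {r : ℝ}
    (hφ : tsupport φ ⊆ Metric.closedBall a r) (h : T φ ≠ 0) :
    ∃ g ∈ supp T, g ∈ Metric.closedBall a r := by
  by_contra! hcon
  exact h (apply_eq_zero_of_disjoint_supp (hasCompactSupport_of_tsupport_subset hφ)
    (Set.disjoint_left.2 fun x hx hxT => hcon x hxT (hφ hx)))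

/-- If the points were too close, no translate of test functions near both could be seen twice by
`F`, and the polynomial alternative would remove one point from every support. The two indices may
differ, so points of different spectra are separated too. -/
theorem le_edist_of_mem_supp
    (hF : ∀ φ, F φ = ∑ k ∈ S, ν k (mulMonomial k φ))
    (hrec : ∀ ω : Euc d, ∃ 𝓤 : Filter ℕ, 𝓤.NeBot ∧ 𝓤 ≤ Filter.atTop ∧ ∀ k ∈ S, ∀ φ, ∀ s : ℝ,
      Filter.Tendsto (fun n : ℕ => ν k (translate ((s + n) • ω) φ)) 𝓤
        (nhds (ν k (translate (s • ω) φ))))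
    {k₁ k₂ : Fin d → ℕ} (hk₁ : k₁ ∈ S) (hk₂ : k₂ ∈ S) {g₁ g₂ : Euc d}
    (hg₁ : g₁ ∈ supp (ν k₁)) (hg₂ : g₂ ∈ supp (ν k₂)) (hne : g₁ ≠ g₂) :
    sepConst (supp F) ≤ edist g₁ g₂ := by
  by_contra! hlt
  obtain ⟨e, he1, he2⟩ := ENNReal.lt_iff_exists_nnreal_btwn.1 hlt
  rw [edist_nndist, ENNReal.coe_lt_coe, ← NNReal.coe_lt_coe, coe_nndist] at he1
  have hdist : 0 < dist g₁ g₂ := dist_pos.2 hne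
  -- Small enough that the two δ-balls are disjoint and any two of their points are less than e
  -- apart.
  obtain ⟨δ, hδ0, hδ⟩ : ∃ δ > 0, 2 * δ < min (dist g₁ g₂) (e - dist g₁ g₂) := by
    have hmin : 0 < min (dist g₁ g₂) (e - dist g₁ g₂) := lt_min hdist (by linarith)
    exact ⟨min (dist g₁ g₂) (e - dist g₁ g₂) / 4, by linarith, by linarith⟩
  have hδ1 := hδ.trans_le (min_le_left _ _)
  have hδ2 := hδ.trans_le (min_le_right _ _)
  let W : Euc d → Set 𝓢(Euc d, ℂ) := fun g => {φ | tsupport φ ⊆ Metric.closedBall g δ}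
  have hW : ∀ g, ∀ φ ∈ W g, ∀ l, mulMonomial l φ ∈ W g := fun g φ hφ l =>
    ((SchwartzMap.tsupport_smulLeftCLM_subset _ _).trans Set.inter_subset_left).trans hφ
  have halt : ∀ φ₁ ∈ W g₁, ∀ φ₂ ∈ W g₂, shiftPolynomial S ν φ₁ = 0 ∨ shiftPolynomial S ν φ₂ = 0 := by
    intro φ₁ h₁ φ₂ h₂
    refine shiftPolynomial_eq_zero_or hF hrec fun t => ?_
    by_contra! hcon
    obtain ⟨x, hxF, hx⟩ := mem_supp_of_apply_ne_zero (tsupport_translate_subset h₁) hcon.1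
    obtain ⟨y, hyF, hy⟩ := mem_supp_of_apply_ne_zero (tsupport_translate_subset h₂) hcon.2
    rw [Metric.mem_closedBall] at hx hy
    have htr : dist (g₁ + t) (g₂ + t) = dist g₁ g₂ := dist_add_right _ _ _
    have hxy : x ≠ y := by
      rintro rfl
      have := dist_triangle_left (g₁ + t) (g₂ + t) x
      linarith
    have hle : (e : ENNReal) < edist x y := he2.trans_le (Set.einfsep_le_edist_of_mem hxF hyF hxy)
    rw [edist_nndist, ENNReal.coe_lt_coe, ← NNReal.coe_lt_coe, coe_nndist] at hle
    have := dist_triangle4 x (g₁ + t) (g₂ + t) y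
    rw [dist_comm (g₂ + t) y] at this
    linarith
  have hout : ∀ g, (∀ φ ∈ W g, shiftPolynomial S ν φ = 0) → ∀ k ∈ S, g ∉ supp (ν k) := by
    intro g h k hk
    refine (notMem_dsupport_iff g).2 ⟨Metric.ball g δ, fun φ hφ => ?_, Metric.isOpen_ball,
      Metric.mem_ball_self hδ0⟩
    exact eq_zero_of_shiftPolynomial_eq_zero (hW g) h k hk φ (hφ.trans Metric.ball_subset_closedBall)
  -- A single φ₁ with nonzero shift polynomial forces every φ₂ near g₂ to have a zero one, so the
  -- alternative holds for whole neighbourhoods.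
  by_cases hall : ∀ φ ∈ W g₁, shiftPolynomial S ν φ = 0
  · exact hout g₁ hall k₁ hk₁ hg₁
  · push Not at hall
    obtain ⟨φ₁, h₁, hne₁⟩ := hall
    exact hout g₂ (fun φ₂ h₂ => (halt φ₁ h₁ φ₂ h₂).resolve_left hne₁) k₂ hk₂ hg₂

end Separation

/-! ### Assembly of the theorem -/

theorem isUniformlyDiscrete_of_sepConst_pos {A : Set (Euc d)} (h : 0 < sepConst A) :
    IsUniformlyDiscrete A := by
  refine ⟨fun x R => ?_, h⟩
  obtain ⟨r, hr0, -, hr⟩ := exists_isolating_of_le_sepConst (d := d) h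
  -- Each ball of half the isolation radius contains at most one point of A.
  obtain ⟨t, -, ht, hcov⟩ := finite_cover_balls_of_compact (isCompact_closedBall x R) (half_pos hr0)
  refine (ht.biUnion (t := fun y => A ∩ Metric.ball y (r / 2)) fun y _ =>
    Set.Subsingleton.finite fun u hu v hv => ?_).subset fun z hz => ?_
  · refine (hr A le_rfl v hv.1 ⟨hu.1, ?_⟩ : u = v)
    have h1 := Metric.mem_ball.1 hu.2
    have h2 := Metric.mem_ball'.1 hv.2
    exact Metric.mem_ball.2 ((dist_triangle u y v).trans_lt (by linarith))
  · obtain ⟨y, hy, hzy⟩ := Set.mem_iUnion₂.1 (hcov (Metric.ball_subset_closedBall hz.2))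
    exact Set.mem_iUnion₂.2 ⟨y, hy, hz.1, hzy⟩

theorem supp_zero : supp (0 : 𝓢'(Euc d, ℂ)) = ∅ :=
  Set.eq_empty_of_forall_notMem fun x => (notMem_dsupport_iff x).2
    ⟨Set.univ, fun _ _ => rfl, isOpen_univ, Set.mem_univ x⟩

/-- The coefficients of a distribution with a support of bounded density and a uniformly discrete
spectrum form distributions whose spectra are separated at least as well. -/
theorem exists_coefficient_distributions {f : 𝓢'(Euc d, ℂ)} {p : Euc d → ((Fin d → ℕ) →₀ ℂ)}
    (hf : IsDeltaDerivSum f (supp f) p) (hΛ : HasBoundedDensity (supp f))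
    (hΓ : IsUniformlyDiscrete (spec f)) {C : ℝ} {N : ℕ}
    (hp : ∀ k, ∀ l ∈ supp f, ‖p l k‖ ≤ C * (1 + ‖l‖) ^ N) :
    ∃ μ : (Fin d → ℕ) → 𝓢'(Euc d, ℂ), (∀ k, IsDeltaSum (μ k) (supp f) (fun l => p l k)) ∧
      ∃ (q : (Fin d → ℕ) → Euc d → ((Fin d → ℕ) →₀ ℂ)) (C' : ℝ), ∀ k,
        IsDeltaDerivSum (𝓕 (μ k)) (spec (μ k)) (q k) ∧
        (∀ g ∈ spec (μ k), ∀ m, q k g m ≠ 0 → len m ≤ N) ∧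
        (∀ g ∈ spec (μ k), ∀ m, ‖q k g m‖ ≤ C') ∧
        IsUniformlyDiscrete (spec (μ k)) ∧ sepConst (spec f) ≤ sepConst (spec (μ k)) := by
  choose μ hμ using fun k => hΛ.exists_distribution (c := fun l => p l k) (hp k)
  obtain ⟨K, hK, -⟩ := hf.exists_order_growth hΛ.1
  have hF : ∀ φ, 𝓕 f φ = ∑ k ∈ multiIndices d K, 𝓕 (μ k) (mulMonomial k φ) := by
    intro φ
    rw [TemperedDistribution.fourier_apply, hf.eq_sum hK fun k φ => (hμ k φ).2]
    simp only [dualDeriv_fourier, TemperedDistribution.fourier_apply]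
  have hrec : ∀ ω : Euc d, ∃ 𝓤 : Filter ℕ, 𝓤.NeBot ∧ 𝓤 ≤ Filter.atTop ∧
      ∀ k ∈ multiIndices d K, ∀ φ, ∀ s : ℝ,
        Filter.Tendsto (fun n : ℕ => 𝓕 (μ k) (translate ((s + n) • ω) φ)) 𝓤
          (nhds (𝓕 (μ k) (translate (s • ω) φ))) := by
    intro ω
    obtain ⟨𝓤, hne, hle, h⟩ := exists_recurrence_filter fun a : supp f => -inner ℝ ω (a : Euc d)
    exact ⟨𝓤, hne, hle, fun k _ φ s => tendsto_fourier_translate (c := fun l => p l k) (hμ k) h φ s⟩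
  -- Indices outside the finite decomposition have empty spectrum, so separation is trivial for
  -- them.
  have hzero : ∀ k, K < len k → μ k = 0 := by
    intro k hk
    ext φ
    have h0 : ∀ a : supp f, p a k * φ a = 0 := fun a => by rw [hK a a.2 k hk, zero_mul]
    have h1 := (hμ k φ).2
    simp only [h0] at h1
    exact h1.unique hasSum_zero
  have hsep : ∀ k, sepConst (spec f) ≤ sepConst (spec (μ k)) := by
    intro k
    refine Set.le_einfsep fun g₁ hg₁ g₂ hg₂ hne => ?_
    have hk : k ∈ multiIndices d K := by
      rw [mem_multiIndices]
      by_contra hk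
      rw [spec, hzero k (not_le.1 hk), FourierTransform.fourier_zero, supp_zero] at hg₁
      exact hg₁
    exact le_edist_of_mem_supp hF hrec hk hk hg₁ hg₂ hne
  have hud : ∀ k, IsUniformlyDiscrete (spec (μ k)) := fun k =>
    isUniformlyDiscrete_of_sepConst_pos (hΓ.2.trans_le (hsep k))
  choose q hq using fun k => exists_isDeltaDerivSum (hud k).1
  -- The radius is taken from η(Γ), which bounds every η(Γ_k) from below; this makes the coefficient
  -- bound uniform in k.
  obtain ⟨r, hr0, hr1, hr⟩ := exists_isolating_of_le_sepConst (d := d) hΓ.2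
  obtain ⟨B, hB⟩ := hΛ.exists_fourier_rescale_bound C N
  obtain ⟨C', hC'⟩ := exists_coeff_bound (d := d) (N := N) hr0 hr1 B
  have hcoeff := fun k => hC' _ _ _ (hq k) (hr _ (hsep k)) fun Φ _ a ε hε hε1 =>
    hB (fun l => p l k) _ (hp k) (fun φ => (hμ k φ).2) Φ a ε hε hε1
  exact ⟨μ, fun k φ _ => (hμ k φ).2, q, C', fun k => ⟨hq k, fun g hg m => (hcoeff k g hg m).1,
    fun g hg m => (hcoeff k g hg m).2, hud k, hsep k⟩⟩

theorem IsDeltaDerivSum.isDeltaSum {f : 𝓢'(Euc d, ℂ)} {A : Set (Euc d)}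
    {p : Euc d → ((Fin d → ℕ) →₀ ℂ)} (hf : IsDeltaDerivSum f A p)
    (hp : ∀ a ∈ A, ∀ m, p a m ≠ 0 → len m ≤ 0) : IsDeltaSum f A fun a => p a 0 := by
  intro φ hφ
  convert hf φ hφ using 2 with a
  rw [Finsupp.sum_of_support_subset (s := {0}), Finset.sum_singleton, multiDeriv_apply,
    dualDeriv_zero]
  · rfl
  · intro m hm
    have := hp a a.2 m (Finsupp.mem_support_iff.1 hm)
    refine Finset.mem_singleton.2 (funext fun j => ?_)
    exact (Finset.sum_eq_zero_iff.1 (Nat.le_zero.1 this)) j (Finset.mem_univ j)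
  · simp

end DiscreteDistribution

end

theorem theorem11 (d : ℕ) (f : 𝓢'(DiscreteDistribution.Euc d, ℂ))
    (p : DiscreteDistribution.Euc d → ((Fin d → ℕ) →₀ ℂ))
    (hf : DiscreteDistribution.IsDeltaDerivSum f (DiscreteDistribution.supp f) p)
    (hΛ : DiscreteDistribution.HasBoundedDensity (DiscreteDistribution.supp f))
    (hΓ : DiscreteDistribution.IsUniformlyDiscrete (DiscreteDistribution.spec f)) :
    ((∃ C : ℝ, ∀ k, ∀ l ∈ DiscreteDistribution.supp f, ‖p l k‖ ≤ C) →
      ∃ μ : (Fin d → ℕ) → 𝓢'(DiscreteDistribution.Euc d, ℂ),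
        (∀ k, DiscreteDistribution.IsDeltaSum (μ k) (DiscreteDistribution.supp f)
          (fun l => p l k)) ∧
        ∃ (q : (Fin d → ℕ) → DiscreteDistribution.Euc d → ℂ) (C : ℝ), ∀ k,
          DiscreteDistribution.IsDeltaSum (𝓕 (μ k)) (DiscreteDistribution.spec (μ k)) (q k) ∧
          (∀ g ∈ DiscreteDistribution.spec (μ k), ‖q k g‖ ≤ C) ∧
          DiscreteDistribution.IsUniformlyDiscrete (DiscreteDistribution.spec (μ k)) ∧
          DiscreteDistribution.sepConst (DiscreteDistribution.spec f) ≤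
            DiscreteDistribution.sepConst (DiscreteDistribution.spec (μ k))) ∧
    (DiscreteDistribution.IsUniformlyDiscrete (DiscreteDistribution.supp f) →
      ∃ μ : (Fin d → ℕ) → 𝓢'(DiscreteDistribution.Euc d, ℂ),
        (∀ k, DiscreteDistribution.IsDeltaSum (μ k) (DiscreteDistribution.supp f)
          (fun l => p l k)) ∧
        ∃ (M : ℕ) (q : (Fin d → ℕ) → DiscreteDistribution.Euc d → ((Fin d → ℕ) →₀ ℂ)) (C : ℝ),
          ∀ k,
          DiscreteDistribution.IsDeltaDerivSum (𝓕 (μ k)) (DiscreteDistribution.spec (μ k))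
            (q k) ∧
          (∀ g ∈ DiscreteDistribution.spec (μ k), ∀ m, q k g m ≠ 0 →
            DiscreteDistribution.len m ≤ M) ∧
          (∀ g ∈ DiscreteDistribution.spec (μ k), ∀ m, ‖q k g m‖ ≤ C) ∧
          DiscreteDistribution.IsUniformlyDiscrete (DiscreteDistribution.spec (μ k)) ∧
          DiscreteDistribution.sepConst (DiscreteDistribution.spec f) ≤
            DiscreteDistribution.sepConst (DiscreteDistribution.spec (μ k))) := by
  refine ⟨fun ⟨C, hC⟩ => ?_, fun hud => ?_⟩
  -- Bounded coefficients mean growth exponent N = 0, so only order 0 survives and the transforms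
  -- are measures.
  · obtain ⟨μ, hμ, q, C', hq⟩ := DiscreteDistribution.exists_coefficient_distributions hf hΛ hΓ
      (C := C) (N := 0) (fun k l hl => by simpa using hC k l hl)
    exact ⟨μ, hμ, fun k g => q k g 0, C', fun k => ⟨(hq k).1.isDeltaSum (hq k).2.1,
      fun g hg => (hq k).2.2.1 g hg 0, (hq k).2.2.2⟩⟩
  -- Uniform discreteness of Λ gives growth exponent K, which is also the order bound M of the
  -- transforms.
  · obtain ⟨K, -, hK⟩ := hf.exists_order_growth hΛ.1
    obtain ⟨C, hC⟩ := hK hud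
    obtain ⟨μ, hμ, q, C', hq⟩ :=
      DiscreteDistribution.exists_coefficient_distributions hf hΛ hΓ hC
    exact ⟨μ, hμ, K, q, C', hq⟩
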